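/- **Setting.** Let $\mathcal T_{\mathcal I}$ be a cluster tree for a finite index set $\mathcal I$: a finite rooted tree whose nodes (clusters) $t$ carry labels $\hat t\subseteq\mathcal I$, the root being labelled by $\mathcal I$, such that $\hat t$ is the disjoint union of the labels of the sons of $t$ whenever $t$ is not a leaf. Each cluster has two sons or none. Let $p_{\mathcal I}$ be the depth (largest level) of the tree, let $\operatorname{sons}^+(t)=\operatorname{sons}(t)$ if $t$ is not a leaf and $\operatorname{sons}^+(t)=\{t\}$ otherwise, and let $\mathcal T_{\hat t}$ be the subtree with root $t$. Let $\mathcal T_{\mathcal I\times\mathcal I}$ be a block tree: its nodes are pairs of clusters, its root is the pair of roots, and the set of sons of a block $(t,s)$ is either empty or $\operatorname{sons}^+(t)\times\operatorname{sons}^+(s)$, which is possible only if $t$ or $s$ is not a leaf. Its leaves are divided into admissible and inadmissible ones, both clusters of an inadmissible leaf being leaves of $\mathcal T_{\mathcal I}$. Assume $\#\{s:(t,s)\in\mathcal T_{\mathcal I\times\mathcal I}\}\le C_{\rm sp}$ for all $t$ and $\#\{t:(t,s)\in\mathcal T_{\mathcal I\times\mathcal I}\}\le C_{\rm sp}$ for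 all $s$. Let $k\ge 1$, and assume $k^3\,\#\mathcal T_{\hat t}\le C_{\rm tree}\,k^2\,\#\hat t$ for all clusters $t$ and $\#\hat t\le C_{\rm lf}\,k$ for all leaf clusters $t$. **Algorithm.** For $\mathcal H^2$-matrices $X,Y,Z$ of rank $k$ for this block tree (in nested representation; for $Z$, triangular factors of the bases and weight matrices are stored as well), the update $Z|_{\hat t\times\hat r}\gets Z|_{\hat t\times\hat r}+X|_{\hat t\times\hat s}Y|_{\hat s\times\hat r}$ is performed (with approximation) as follows. If $(t,s)$ or $(s,r)$ is a leaf block, the factorized form of this leaf is multiplied by the other $\mathcal H^2$-submatrix and the resulting low-rank matrix is added to the target. Otherwise, the update is performed recursively for all $(t',s',r')\in\operatorname{sons}^+(t)\times\operatorname{sons}^+(s)\times\operatorname{sons}^+(r)$; if the target $(t,r)$ is an admissible leaf or itself a temporary matrix, the results for each $(t',r')$ are collected in a temporary rank-$k$ matrix, which is then extended by zero and added to the target. Adding a low-rank matrix to a block of $Z$ means a local update: the row basis in $\mathcal T_{\hat t}$ and the column basis in $\mathcal T_{\hat r}$ are extended by the factors, weight matrices that take all admissible blocks connected to these subtrees into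 account are computed, the bases are truncated to rank $k$ by singular value decompositions, and all connected coupling matrices are converted; a low-rank matrix is added to a temporary matrix by truncated addition. Dense sums and products cost their number of arithmetic operations (a product of an $m\times n$ and an $n\times p$ matrix costs $2mnp$); a QR factorization or a singular value decomposition of an $m\times n$ matrix costs at most $C_{\rm qr}\,mn\min\{m,n\}$ or $C_{\rm svd}\,mn\min\{m,n\}$ operations; copying and transposition are free. Let $W_{\rm mm}(t,s,r)$ be the number of operations required for the update in the worst case (over all $X$, $Y$, and all targets, whether a block of $Z$ or a temporary matrix). The triple tree $\mathcal T_{\mathcal I\times\mathcal I\times\mathcal I}$ has the root $(\operatorname{root},\operatorname{root},\operatorname{root})$; a triple $(t,s,r)$ has the sons $\operatorname{sons}^+(t)\times\operatorname{sons}^+(s)\times\operatorname{sons}^+(r)$ if neither $(t,s)$ nor $(s,r)$ is a leaf block, and no sons otherwise. **Theorem (Complexity, multiplication).** There is a constant $C_{\rm mb}$, depending only on $C_{\rm sp},C_{\rm tree},C_{\rm lf},C_{\rm qr},C_{\rm svd}$, such that for all $t,s,r\in\mathcal T_{\mathcal I}$ with $(t,s),(s,r)\in\mathcal T_{\mathcal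 I\times\mathcal I}$ $$W_{\rm mm}(t,s,r)\le C_{\rm mb}\,k^2(\#\hat t+\#\hat s+\#\hat r)\quad\text{if }(t,s)\text{ or }(s,r)\text{ is a leaf block},$$ $$W_{\rm mm}(t,s,r)\le C_{\rm mb}\,k^2(\#\hat t+\#\hat s+\#\hat r)+\sum_{\substack{t'\in\operatorname{sons}^+(t),\ s'\in\operatorname{sons}^+(s),\\ r'\in\operatorname{sons}^+(r)}}W_{\rm mm}(t',s',r')\quad\text{otherwise},$$ and for every constant $C_{\rm mb}\ge 0$ with these two properties (for the given trees, $k$, and factorization routines) we have $$W_{\rm mm}(t_0,s_0,r_0)\le C_{\rm mm}\,k^2\,(p_{\mathcal I}+1)\,(\#\hat t_0+\#\hat s_0+\#\hat r_0),\qquad C_{\rm mm}:=C_{\rm sp}^2\,C_{\rm mb},$$ for all $(t_0,s_0,r_0)\in\mathcal T_{\mathcal I\times\mathcal I\times\mathcal I}$. -/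

import Mathlib

open scoped ENNReal NNReal Matrix

noncomputable section

namespace H2Mult

/-! ### Cluster trees -/

/-- A cluster tree for a finite index set `I`: a finite rooted tree with labelled nodes.
The tree is given by the father of each node (`none` exactly for the root); `level t` is the
distance from the root, which the two level laws determine, and whose existence
says that every node is connected to the root. -/
structure ClusterTree (I : Type) [Fintype I] [DecidableEq I] where
  Node : Type
  [fintypeNode : Fintype Node]
  [decEqNode : DecidableEq Node]
  root : Node
  father : Node → Option Node
  level : Node → ℕ
  label : Node → Finset I
  father_eq_none_iff : ∀ t, father t = none ↔ t = root
  level_root : level root = 0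
  level_of_father : ∀ t a, father t = some a → level t = level a + 1
  label_root : label root = Finset.univ
  label_eq_biUnion : ∀ t, (Finset.univ.filter fun u => father u = some t).Nonempty →
    label t = (Finset.univ.filter fun u => father u = some t).biUnion label
  label_disjoint : ∀ t t₁ t₂, father t₁ = some t → father t₂ = some t → t₁ ≠ t₂ →
    Disjoint (label t₁) (label t₂)

attribute [instance] ClusterTree.fintypeNode ClusterTree.decEqNode

/-! ### Counting arithmetic operations -/

/-- A computed value together with the number of arithmetic operations spent on it. -/
structure Counted (α : Type) where
  val : α
  ops : ℕ

instance : Monad Counted where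
  pure a := ⟨a, 0⟩
  bind x f := ⟨(f x.val).val, x.ops + (f x.val).ops⟩

/-- Independent computations, one for each element of `ι`. -/
def forAll {ι : Type} [Fintype ι] {β : ι → Type} (f : ∀ i, Counted (β i)) :
    Counted (∀ i, β i) :=
  ⟨fun i => (f i).val, ∑ i, (f i).ops⟩

open scoped Classical in
/-- Independent computations for the elements of `s`; the other entries keep their old value. -/
def forEach {ι : Type} (s : Finset ι) {β : ι → Type} (old : ∀ i, β i)
    (f : ∀ i, Counted (β i)) : Counted (∀ i, β i) :=
  ⟨fun i => if i ∈ s then (f i).val else old i, ∑ i ∈ s, (f i).ops⟩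

/-- Sequential computation: the steps for the elements of `s` are carried out one after the
other and transform the accumulated value. -/
def foldOver {ι β : Type} (s : Finset ι) (init : β)
    (f : {i // i ∈ s} → β → Counted β) : Counted β :=
  s.attach.toList.foldlM (fun acc i => f i acc) init

section Dense

variable {ι m n p : Type} [Fintype ι] [Fintype m] [Fintype n] [Fintype p]

/-- Dense matrix product. -/
def mulC (A : Matrix m n ℝ) (B : Matrix n p ℝ) : Counted (Matrix m p ℝ) :=
  ⟨A * B, 2 * Fintype.card m * Fintype.card n * Fintype.card p⟩

/-- Dense matrix sum. -/
def addC (A B : Matrix m n ℝ) : Counted (Matrix m n ℝ) :=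
  ⟨A + B, Fintype.card m * Fintype.card n⟩

/-- Computation and accumulation of finitely many dense matrices. -/
def sumC (f : ι → Counted (Matrix m n ℝ)) : Counted (Matrix m n ℝ) :=
  ⟨∑ i, (f i).val, ∑ i, (f i).ops + Fintype.card ι * (Fintype.card m * Fintype.card n)⟩

/-- The blocks `M i` put below each other. -/
def stack (M : ι → Matrix p n ℝ) : Matrix (ι × p) n ℝ :=
  fun i j => M i.1 i.2 j

/-- The first `j` columns of `Q` are orthonormal left singular vectors of `M` belonging to
the `j` largest singular values, the remaining columns of `Q` are zero. -/
def IsLeadingSingularBasis {k : ℕ} (M : Matrix m n ℝ) (Q : Matrix m (Fin k) ℝ) : Prop :=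
  ∃ (j : ℕ) (σ : Fin k → ℝ),
    Qᵀ * Q = Matrix.diagonal (fun a => if a.1 < j then 1 else 0) ∧
    M * Mᵀ * Q = Q * Matrix.diagonal (fun a => σ a ^ 2) ∧
    ∀ x : m → ℝ, Qᵀ *ᵥ x = 0 → ∀ a : Fin k, a.1 < j →
      x ⬝ᵥ ((M * Mᵀ) *ᵥ x) ≤ σ a ^ 2 * (x ⬝ᵥ x)

end Dense

/-- Routines for the two dense factorizations. `qr A` is the (square) right factor `R` of a
thin QR factorization `A = P R`, i.e. `Rᵀ R = Aᵀ A`. `lead k M` returns at most `k` leading left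
singular vectors of `M` (padded by zero columns); how many of them are kept is the truncation
strategy and is left open. An `m × n` matrix costs `qrConst * m * n * min m n` and
`svdConst * m * n * min m n` operations, respectively. -/
structure Kernel where
  qrConst : ℕ
  svdConst : ℕ
  qr : ∀ {m n : Type} [Fintype m] [Fintype n], Matrix m n ℝ → Matrix n n ℝ
  qr_gram : ∀ {m n : Type} [Fintype m] [Fintype n] (A : Matrix m n ℝ),
    (qr A)ᵀ * qr A = Aᵀ * A
  lead : ∀ {m n : Type} [Fintype m] [Fintype n] (k : ℕ), Matrix m n ℝ → Matrix m (Fin k) ℝ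
  lead_spec : ∀ {m n : Type} [Fintype m] [Fintype n] (k : ℕ) (M : Matrix m n ℝ),
    IsLeadingSingularBasis M (lead k M)

namespace Kernel

variable (K : Kernel) {m n : Type} [Fintype m] [Fintype n]

def qrC (A : Matrix m n ℝ) : Counted (Matrix n n ℝ) :=
  ⟨K.qr A, K.qrConst * (Fintype.card m * Fintype.card n *
    min (Fintype.card m) (Fintype.card n))⟩

def leadC (k : ℕ) (M : Matrix m n ℝ) : Counted (Matrix m (Fin k) ℝ) :=
  ⟨K.lead k M, K.svdConst * (Fintype.card m * Fintype.card n *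
    min (Fintype.card m) (Fintype.card n))⟩

end Kernel

/-! ### Clusters, subtrees and sweeps through a cluster tree -/

namespace ClusterTree

variable {I : Type} [Fintype I] [DecidableEq I] (T : ClusterTree I)

def sons (t : T.Node) : Finset T.Node :=
  Finset.univ.filter fun u => T.father u = some t

/-- `sons t` if this set is not empty, and `{t}` otherwise. -/
def sonsPlus (t : T.Node) : Finset T.Node :=
  if T.sons t = ∅ then {t} else T.sons t

open scoped Classical in
/-- The nodes of the subtree with root `t`. -/
def subtree (t : T.Node) : Finset T.Node :=
  Finset.univ.filter fun u => Relation.ReflTransGen (fun a b => T.father b = some a) t u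

/-- The leaf clusters of the subtree with root `t`. -/
def leavesOf (t : T.Node) : Finset T.Node :=
  (T.subtree t).filter fun u => T.sons u = ∅

/-- The depth of the cluster tree, i.e. the largest level. -/
def depth : ℕ := Finset.univ.sup T.level

/-- Each cluster has two sons or none. -/
def IsBinary : Prop := ∀ t, T.sons t = ∅ ∨ (T.sons t).card = 2

/-- The row (or column) indices belonging to the cluster `t`. -/
abbrev Idx (t : T.Node) : Type := {i : I // i ∈ T.label t}

variable {T}

theorem mem_sons {t u : T.Node} : u ∈ T.sons t ↔ T.father u = some t := by
  simp [sons]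

theorem level_le_depth (t : T.Node) : T.level t ≤ T.depth :=
  Finset.le_sup (f := T.level) (Finset.mem_univ t)

theorem rem_son_lt {t u : T.Node} (h : u ∈ T.sons t) :
    T.depth - T.level u < T.depth - T.level t := by
  have h1 := T.level_of_father u t (mem_sons.1 h)
  have h2 := level_le_depth u
  omega

theorem rem_sonsPlus_le {t u : T.Node} (h : u ∈ T.sonsPlus t) :
    T.depth - T.level u ≤ T.depth - T.level t := by
  unfold sonsPlus at h
  split_ifs at h with h0
  · rw [Finset.mem_singleton.1 h]
  · exact (rem_son_lt h).le

theorem rem_sonsPlus_lt {t u : T.Node} (h0 : T.sons t ≠ ∅) (h : u ∈ T.sonsPlus t) :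
    T.depth - T.level u < T.depth - T.level t := by
  unfold sonsPlus at h
  rw [if_neg h0] at h
  exact rem_son_lt h

variable (T)

/-- The table of results of a bottom-up recursion: the result for `t` is computed from the
results for the sons of `t`. -/
def upVal {α : T.Node → Type}
    (step : ∀ t, (∀ u : {u // u ∈ T.sons t}, α u) → Counted (α t)) (t : T.Node) : α t :=
  (step t (fun u => upVal step u.1)).val
termination_by T.depth - T.level t
decreasing_by exact rem_son_lt u.2

open scoped Classical in
/-- Bottom-up recursion through the subtree of `t₀`, each entry being computed once. Entries for
other clusters are not computed and keep the old value. -/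
def sweepUp {α : T.Node → Type} (t₀ : T.Node) (old : ∀ t, α t)
    (step : ∀ t, (∀ u : {u // u ∈ T.sons t}, α u) → Counted (α t)) :
    Counted (∀ t, α t) :=
  ⟨fun t => if t ∈ T.subtree t₀ then T.upVal step t else old t,
    ∑ t ∈ T.subtree t₀, (step t (fun u => T.upVal step u.1)).ops⟩

/-- The table of results of a top-down recursion starting with `first` in `t₀`: the result for
`t` is computed from the result for the father of `t`. -/
def downVal {α : Type} (t₀ : T.Node) (first : Counted α) (step : T.Node → α → Counted α)
    (t : T.Node) : α :=
  if t = t₀ then first.val else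
    match h : T.father t with
    | some a => (step t (downVal t₀ first step a)).val
    | none => first.val
termination_by T.level t
decreasing_by
  have := T.level_of_father t a h
  omega

open scoped Classical in
/-- Top-down recursion through the subtree of `t₀`, each entry being computed once. Entries for
other clusters are not computed and keep the old value. -/
def sweepDown {α : Type} (t₀ : T.Node) (old : T.Node → α) (first : Counted α)
    (step : T.Node → α → Counted α) : Counted (T.Node → α) :=
  ⟨fun t => if t ∈ T.subtree t₀ then T.downVal t₀ first step t else old t,
    first.ops + ∑ t ∈ (T.subtree t₀).erase t₀,
      match T.father t with
      | some a => (step t (T.downVal t₀ first step a)).ops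
      | none => 0⟩

variable {T} {κ : Type}

/-- Restriction of a matrix with rows in `t` to the rows in `u`; rows of `u` that do not belong
to `t` are set to zero (so this is also the extension by zero). -/
def restr {t : T.Node} (u : T.Node) (A : Matrix (T.Idx t) κ ℝ) : Matrix (T.Idx u) κ ℝ :=
  fun i j => if h : i.1 ∈ T.label t then A ⟨i.1, h⟩ j else 0

/-- The matrix with rows in `t₀` that is composed of blocks for the leaf clusters below `t₀`
(whose labels are a disjoint partition of the label of `t₀`). -/
def assemble (t₀ : T.Node) (y : ∀ t, Matrix (T.Idx t) κ ℝ) : Matrix (T.Idx t₀) κ ℝ :=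
  fun i j => ∑ t ∈ T.leavesOf t₀, if h : i.1 ∈ T.label t then y t ⟨i.1, h⟩ j else 0

end ClusterTree

variable {I : Type} [Fintype I] [DecidableEq I]

/-! ### Block trees and the triple tree -/

/-- A block tree for `T` and `T`, with its leaves split into admissible and
inadmissible ones. A block is split until it is admissible or
both of its clusters are leaves. -/
structure BlockTree (T : ClusterTree I) where
  blocks : Finset (T.Node × T.Node)
  sons : T.Node × T.Node → Finset (T.Node × T.Node)
  adm : Finset (T.Node × T.Node)
  root_mem : (T.root, T.root) ∈ blocks
  sons_of_notMem : ∀ b, b ∉ blocks → sons b = ∅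
  sons_subset : ∀ b, sons b ⊆ blocks
  exists_father : ∀ b ∈ blocks, b ≠ (T.root, T.root) → ∃ a ∈ blocks, b ∈ sons a
  sons_eq : ∀ t s, sons (t, s) ≠ ∅ → sons (t, s) =
    if T.sons t = ∅ then {t} ×ˢ T.sons s
    else if T.sons s = ∅ then T.sons t ×ˢ {s}
    else T.sons t ×ˢ T.sons s
  adm_subset : ∀ b ∈ adm, b ∈ blocks ∧ sons b = ∅
  leaf_of_inadm : ∀ t s, (t, s) ∈ blocks → sons (t, s) = ∅ → (t, s) ∉ adm →
    T.sons t = ∅ ∧ T.sons s = ∅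

namespace BlockTree

variable {T : ClusterTree I} (B : BlockTree T)

def leaves : Finset (T.Node × T.Node) := B.blocks.filter fun b => B.sons b = ∅

/-- The inadmissible leaves. -/
def inadm : Finset (T.Node × T.Node) := B.leaves \ B.adm

/-- `C` bounds the number of blocks in each block row and each block column. -/
def IsSparse (C : ℝ≥0) : Prop :=
  (∀ t, ((Finset.univ.filter fun s => (t, s) ∈ B.blocks).card : ℝ≥0) ≤ C) ∧
  (∀ s, ((Finset.univ.filter fun t => (t, s) ∈ B.blocks).card : ℝ≥0) ≤ C)

/-- One of the factors of the product for the triple `(t, s, r)` is not subdivided. -/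
def IsLeafTriple (t s r : T.Node) : Prop :=
  B.sons (t, s) = ∅ ∨ B.sons (s, r) = ∅

/-- The triples in the triple tree. -/
inductive IsTriple : T.Node → T.Node → T.Node → Prop
  | root : IsTriple T.root T.root T.root
  | son {t s r t' s' r' : T.Node} : IsTriple t s r → ¬ B.IsLeafTriple t s r →
      t' ∈ T.sonsPlus t → s' ∈ T.sonsPlus s → r' ∈ T.sonsPlus r → IsTriple t' s' r'

variable {B}

theorem rem_triple_lt {t s r t' s' r' : T.Node} (h : ¬ B.IsLeafTriple t s r)
    (ht : t' ∈ T.sonsPlus t) (hs : s' ∈ T.sonsPlus s) (hr : r' ∈ T.sonsPlus r) :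
    (T.depth - T.level t') + (T.depth - T.level s') + (T.depth - T.level r') <
      (T.depth - T.level t) + (T.depth - T.level s) + (T.depth - T.level r) := by
  have h1 : B.sons (t, s) ≠ ∅ := fun h0 => h (Or.inl h0)
  have lt := ClusterTree.rem_sonsPlus_le ht
  have ls := ClusterTree.rem_sonsPlus_le hs
  have lr := ClusterTree.rem_sonsPlus_le hr
  by_cases h2 : T.sons t = ∅
  · have h3 : T.sons s ≠ ∅ := by
      intro h4
      apply h1
      rw [B.sons_eq t s h1, if_pos h2, h4, Finset.product_empty]
    have := ClusterTree.rem_sonsPlus_lt h3 hs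
    omega
  · have := ClusterTree.rem_sonsPlus_lt h2 ht
    omega

end BlockTree

/-! ### Matrices in `ℋ²`-representation -/

/-- A nested cluster basis of rank `k`: for each leaf cluster the matrix `V_t`, and the transfer
matrices `E_t` with `V_t|_{t'} = V_{t'} E_{t'}` for the sons `t'` of a cluster `t`. (Entries
`leafMat t` for other clusters `t` are never used.) -/
structure Basis (T : ClusterTree I) (k : ℕ) where
  leafMat : ∀ t, Matrix (T.Idx t) (Fin k) ℝ
  transfer : T.Node → Matrix (Fin k) (Fin k) ℝ

/-- An `ℋ²`-matrix: the submatrix for an admissible leaf `(t, s)` is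
`V_t * coupling t s * W_sᵀ` with the row basis `V` and the column basis `W`, the submatrix for an
inadmissible leaf is `near t s`. (The other entries of `coupling` and `near` are never used.) -/
structure HTwo (T : ClusterTree I) (k : ℕ) where
  row : Basis T k
  col : Basis T k
  coupling : T.Node → T.Node → Matrix (Fin k) (Fin k) ℝ
  near : ∀ t s, Matrix (T.Idx t) (T.Idx s) ℝ

/-- A cluster basis that can be updated: it comes with the triangular factors `fac t` of thin QR
factorizations of the basis matrices and with the weight matrices `wt t`, i.e. the triangular
factors of the matrices `B_t` with `Z_t = V_t B_tᵀ`, where `Z_t` collects all admissible blocks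
connected to `t` or one of its predecessors. -/
structure WeightedBasis (T : ClusterTree I) (k : ℕ) extends Basis T k where
  fac : T.Node → Matrix (Fin k) (Fin k) ℝ
  wt : T.Node → Matrix (Fin k) (Fin k) ℝ

/-- An `ℋ²`-matrix that can be updated. -/
structure Target (T : ClusterTree I) (k : ℕ) where
  row : WeightedBasis T k
  col : WeightedBasis T k
  coupling : T.Node → T.Node → Matrix (Fin k) (Fin k) ℝ
  near : ∀ t s, Matrix (T.Idx t) (T.Idx s) ℝ

/-- A factorized matrix `left * rightᵀ` of rank at most `ρ`. -/
structure LowRank (m n : Type) (ρ : ℕ) where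
  left : Matrix m (Fin ρ) ℝ
  right : Matrix n (Fin ρ) ℝ

variable {T : ClusterTree I} {k ρ : ℕ}

/-- Extension of a factorized matrix by zero. -/
def LowRank.extend {t r : T.Node} (P : LowRank (T.Idx t) (T.Idx r) ρ) (u v : T.Node) :
    LowRank (T.Idx u) (T.Idx v) ρ :=
  ⟨ClusterTree.restr u P.left, ClusterTree.restr v P.right⟩

def HTwo.transpose (X : HTwo T k) : HTwo T k :=
  ⟨X.col, X.row, fun t s => (X.coupling s t)ᵀ, fun t s => (X.near s t)ᵀ⟩

/-- The basis matrix `V_{t₀}`, computed from the nested representation. -/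
def Basis.expand (b : Basis T k) (t₀ : T.Node) : Counted (Matrix (T.Idx t₀) (Fin k) ℝ) := do
  let c ← T.sweepDown t₀ (fun _ => (0 : Matrix (Fin k) (Fin k) ℝ)) (pure 1)
    (fun t c => mulC (b.transfer t) c)
  let y ← forEach (T.leavesOf t₀) (fun _ => 0) (fun t => mulC (b.leafMat t) (c t))
  pure (ClusterTree.assemble t₀ y)

open scoped Classical in
/-- Multiplication of the submatrix `X|_{t₀ × s₀}` of an `ℋ²`-matrix, with admissible leaves `far`
and inadmissible leaves `near`, by several vectors, the columns of `x`:
forward transformation, coupling, backward transformation, and nearfield. -/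
def HTwo.mulSub {κ : Type} [Fintype κ] (X : HTwo T k) (far near : Finset (T.Node × T.Node))
    (t₀ s₀ : T.Node) (x : Matrix (T.Idx s₀) κ ℝ) : Counted (Matrix (T.Idx t₀) κ ℝ) := do
  let xh ← T.sweepUp (α := fun _ => Matrix (Fin k) κ ℝ) s₀ (fun _ => 0) (fun s ih =>
    if T.sons s = ∅ then mulC (X.col.leafMat s)ᵀ (ClusterTree.restr s x)
    else sumC fun u => mulC (X.col.transfer u.1)ᵀ (ih u))
  let yc ← forEach (T.subtree t₀) (fun _ => (0 : Matrix (Fin k) κ ℝ)) (fun t =>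
    sumC fun s : {s // s ∈ (T.subtree s₀).filter fun s => (t, s) ∈ far} =>
      mulC (X.coupling t s.1) (xh s.1))
  let yh ← T.sweepDown t₀ (fun _ => (0 : Matrix (Fin k) κ ℝ)) (pure (yc t₀)) (fun t c => do
    let z ← mulC (X.row.transfer t) c
    addC (yc t) z)
  let y ← forEach (T.leavesOf t₀) (fun _ => 0) (fun t => do
    let v ← mulC (X.row.leafMat t) (yh t)
    let w ← sumC fun s : {s // s ∈ (T.subtree s₀).filter fun s => (t, s) ∈ near} =>
      mulC (X.near t s.1) (ClusterTree.restr s.1 x)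
    addC v w)
  pure (ClusterTree.assemble t₀ y)

/-- If `(s, r)` or `(t, s)` is a leaf, a factorized representation of the product
`X|_{t × s} * Y|_{s × r}` is obtained by multiplying the factorized representation of the
leaf by the other matrix. For an inadmissible leaf, one of the factors is the identity. -/
def lowRankProduct (B : BlockTree T) (X Y : HTwo T k) (t s r : T.Node) :
    Counted (Σ ρ : ℕ, LowRank (T.Idx t) (T.Idx r) ρ) :=
  if (s, r) ∈ B.adm then do
    let V ← Y.row.expand s
    let XV ← X.mulSub B.adm B.inadm t s V
    let A ← mulC XV (Y.coupling s r)
    let W ← Y.col.expand r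
    pure ⟨k, A, W⟩
  else if (s, r) ∈ B.inadm then do
    let P ← X.mulSub B.adm B.inadm t s (Y.near s r)
    let e := (Fintype.equivFin (T.Idx r)).symm
    pure ⟨Fintype.card (T.Idx r), P.submatrix id e, (1 : Matrix _ _ ℝ).submatrix id e⟩
  else if (t, s) ∈ B.adm then do
    let W ← X.col.expand s
    let YW ← Y.transpose.mulSub (B.adm.image Prod.swap) (B.inadm.image Prod.swap) r s W
    let A ← mulC YW (X.coupling t s)ᵀ
    let V ← X.row.expand t
    pure ⟨k, V, A⟩
  else do
    let P ← Y.transpose.mulSub (B.adm.image Prod.swap) (B.inadm.image Prod.swap) r s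
      (X.near t s)ᵀ
    let e := (Fintype.equivFin (T.Idx t)).symm
    pure ⟨Fintype.card (T.Idx t), (1 : Matrix _ _ ℝ).submatrix id e, P.submatrix id e⟩

/-! ### Local low-rank updates -/

/-- `V_t` extended by the rows of `X` belonging to `t`. -/
def WeightedBasis.extLeaf (b : WeightedBasis T k) {t₀ : T.Node} (X : Matrix (T.Idx t₀) (Fin ρ) ℝ)
    (t : T.Node) : Matrix (T.Idx t) (Fin k ⊕ Fin ρ) ℝ :=
  Matrix.fromCols (b.leafMat t) (ClusterTree.restr t X)

/-- The transfer matrices of the extended basis, below `t₀`. -/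
def WeightedBasis.extTransfer (b : WeightedBasis T k) (ρ : ℕ) (t : T.Node) :
    Matrix (Fin k ⊕ Fin ρ) (Fin k ⊕ Fin ρ) ℝ :=
  Matrix.fromBlocks (b.transfer t) 0 0 1

/-- The matrix `E_{t₀}` for the root of an updated subtree, extended by zero rows. -/
def WeightedBasis.extRootTransfer (b : WeightedBasis T k) (ρ : ℕ) (t₀ : T.Node) :
    Matrix (Fin k ⊕ Fin ρ) (Fin k) ℝ :=
  Matrix.fromRows (b.transfer t₀) 0

/-- Triangular factors of thin QR factorizations of the extended basis matrices in the subtree of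
`t₀`. For the other clusters, the stored factors are used (extended by zero). -/
def WeightedBasis.extFactors (K : Kernel) (b : WeightedBasis T k) (t₀ : T.Node)
    (X : Matrix (T.Idx t₀) (Fin ρ) ℝ) :
    Counted (T.Node → Matrix (Fin k ⊕ Fin ρ) (Fin k ⊕ Fin ρ) ℝ) :=
  T.sweepUp (α := fun _ => Matrix (Fin k ⊕ Fin ρ) (Fin k ⊕ Fin ρ) ℝ) t₀
    (fun t => Matrix.fromBlocks (b.fac t) 0 0 0)
    (fun t ih =>
      if T.sons t = ∅ then K.qrC (b.extLeaf X t)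
      else do
        let M ← forAll fun u : {u // u ∈ T.sons t} => mulC (ih u) (b.extTransfer ρ u.1)
        K.qrC (stack M))

/-- Weight matrices of the extended basis in the subtree of `t₀`. Here `opp s` is the triangular
factor for the opposite basis, `S t s` the extended coupling matrix, and `conn t` the set of all
clusters `s` connected to `t` by an admissible block. -/
def WeightedBasis.extWeights (K : Kernel) (b : WeightedBasis T k) (t₀ : T.Node)
    (opp : T.Node → Matrix (Fin k ⊕ Fin ρ) (Fin k ⊕ Fin ρ) ℝ)
    (S : T.Node → T.Node → Matrix (Fin k ⊕ Fin ρ) (Fin k ⊕ Fin ρ) ℝ)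
    (conn : T.Node → Finset T.Node) :
    Counted (T.Node → Matrix (Fin k ⊕ Fin ρ) (Fin k ⊕ Fin ρ) ℝ) :=
  T.sweepDown t₀ (fun _ => 0)
    (do
      let M ← forAll fun s : {s // s ∈ conn t₀} => mulC (opp s.1) (S t₀ s.1)ᵀ
      let H ← match T.father t₀ with
        | some a => mulC (b.wt a) (b.extRootTransfer ρ t₀)ᵀ
        | none => pure 0
      K.qrC (Matrix.fromRows (stack M) H))
    (fun t c => do
      let M ← forAll fun s : {s // s ∈ conn t} => mulC (opp s.1) (S t s.1)ᵀ
      let H ← mulC c (b.extTransfer ρ t)ᵀ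
      K.qrC (Matrix.fromRows (stack M) H))

/-- The result of the truncation for a cluster `t`: the new basis matrix `Q_t` (if `t` is a leaf),
the transfer matrices for the sons of `t`, and the change of basis `R_t`, i.e. `Q_tᵀ` times the
extended basis matrix. -/
structure Truncated (T : ClusterTree I) (k ρ : ℕ) (t : T.Node) where
  leafMat : Matrix (T.Idx t) (Fin k) ℝ
  sonTransfer : T.Node → Matrix (Fin k) (Fin k) ℝ
  change : Matrix (Fin k) (Fin k ⊕ Fin ρ) ℝ

/-- Truncation of the extended basis in the subtree of `t₀`, with weight matrices `w`. -/
def WeightedBasis.truncate (K : Kernel) (b : WeightedBasis T k) (t₀ : T.Node)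
    (X : Matrix (T.Idx t₀) (Fin ρ) ℝ)
    (w : T.Node → Matrix (Fin k ⊕ Fin ρ) (Fin k ⊕ Fin ρ) ℝ) :
    Counted (∀ t, Truncated T k ρ t) :=
  T.sweepUp t₀ (fun _ => ⟨0, fun _ => 0, 0⟩) (fun t ih =>
    if T.sons t = ∅ then do
      let M ← mulC (b.extLeaf X t) (w t)ᵀ
      let Q ← K.leadC k M
      let R ← mulC Qᵀ (b.extLeaf X t)
      pure ⟨Q, fun _ => 0, R⟩
    else do
      let V ← forAll fun u : {u // u ∈ T.sons t} => mulC (ih u).change (b.extTransfer ρ u.1)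
      let M ← mulC (stack V) (w t)ᵀ
      let Q ← K.leadC k M
      let R ← mulC Qᵀ (stack V)
      pure ⟨0, fun u => if h : u ∈ T.sons t then fun i j => Q (⟨u, h⟩, i) j else 0, R⟩)

open scoped Classical in
/-- The basis resulting from the truncation: new basis and weight matrices in the subtree of `t₀`,
and an adapted transfer matrix in `t₀`. -/
def WeightedBasis.replace (K : Kernel) (b : WeightedBasis T k) (t₀ : T.Node)
    (w : T.Node → Matrix (Fin k ⊕ Fin ρ) (Fin k ⊕ Fin ρ) ℝ)
    (q : ∀ t, Truncated T k ρ t) : Counted (WeightedBasis T k) := do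
  let E₀ ← mulC (q t₀).change (b.extRootTransfer ρ t₀)
  let wt ← forEach (T.subtree t₀) b.wt (fun t => do
    let M ← mulC (w t) (q t).changeᵀ
    K.qrC M)
  pure
    { leafMat := fun t => if t ∈ T.subtree t₀ then (q t).leafMat else b.leafMat t
      transfer := fun t =>
        if t = t₀ then E₀
        else if t ∈ T.subtree t₀ then
          match T.father t with
          | some a => (q a).sonTransfer t
          | none => b.transfer t
        else b.transfer t
      fac := fun t => if t ∈ T.subtree t₀ then 1 else b.fac t
      wt := wt }

open scoped Classical in
/-- The local low-rank update `Z|_{t₀ × r₀} ← Z|_{t₀ × r₀} + P.left * P.rightᵀ`: extension of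
the bases in the subtrees of `t₀` and `r₀`, recompression, and conversion of all
coupling matrices connected to these subtrees. -/
def lowRankUpdate (K : Kernel) (B : BlockTree T) (Z : Target T k) (t₀ r₀ : T.Node)
    (P : LowRank (T.Idx t₀) (T.Idx r₀) ρ) : Counted (Target T k) := do
  let S : T.Node → T.Node → Matrix (Fin k ⊕ Fin ρ) (Fin k ⊕ Fin ρ) ℝ := fun t s =>
    Matrix.fromBlocks (Z.coupling t s) 0 0
      (if t ∈ T.subtree t₀ ∧ s ∈ T.subtree r₀ then 1 else 0)
  let fr ← Z.row.extFactors K t₀ P.left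
  let fc ← Z.col.extFactors K r₀ P.right
  let wr ← Z.row.extWeights K t₀ fc S (fun t => Finset.univ.filter fun s => (t, s) ∈ B.adm)
  let wc ← Z.col.extWeights K r₀ fr (fun s t => (S t s)ᵀ)
    (fun s => Finset.univ.filter fun t => (t, s) ∈ B.adm)
  let qr ← Z.row.truncate K t₀ P.left wr
  let qc ← Z.col.truncate K r₀ P.right wc
  let row ← Z.row.replace K t₀ wr qr
  let col ← Z.col.replace K r₀ wc qc
  let coupling ← forEach
    (B.adm.filter fun b => b.1 ∈ T.subtree t₀ ∨ b.2 ∈ T.subtree r₀)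
    (fun b => Z.coupling b.1 b.2)
    (fun b =>
      if b.1 ∈ T.subtree t₀ then
        if b.2 ∈ T.subtree r₀ then do
          let M ← mulC (qr b.1).change (S b.1 b.2)
          mulC M (qc b.2).changeᵀ
        else mulC (qr b.1).change (Matrix.fromRows (Z.coupling b.1 b.2) 0)
      else mulC (Matrix.fromCols (Z.coupling b.1 b.2) 0) (qc b.2).changeᵀ)
  let near ← forEach (β := fun b : T.Node × T.Node => Matrix (T.Idx b.1) (T.Idx b.2) ℝ)
    (B.inadm.filter fun b => b.1 ∈ T.subtree t₀ ∧ b.2 ∈ T.subtree r₀)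
    (fun b => Z.near b.1 b.2)
    (fun b => do
      let M ← mulC (ClusterTree.restr b.1 P.left) (ClusterTree.restr b.2 P.right)ᵀ
      addC (Z.near b.1 b.2) M)
  pure ⟨row, col, fun t s => coupling (t, s), fun t s => near (t, s)⟩

/-- Truncated addition of factorized matrices: a rank `k` approximation of
`A.left * A.rightᵀ + P.left * P.rightᵀ`. -/
def lowRankAdd {m n : Type} [Fintype m] [Fintype n] (K : Kernel) (A : LowRank m n k)
    (P : LowRank m n ρ) : Counted (LowRank m n k) := do
  let L := Matrix.fromCols A.left P.left
  let R := Matrix.fromCols A.right P.right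
  let F ← K.qrC R
  let M ← mulC L Fᵀ
  let Q ← K.leadC k M
  let C ← mulC Qᵀ L
  let D ← mulC R Cᵀ
  pure ⟨Q, D⟩

/-! ### The multiplication algorithm -/

open scoped Classical in
/-- The update `A ← A + X|_{t × s} * Y|_{s × r}` for a temporary low-rank matrix `A`. If the
factors are subdivided, temporary matrices for the pairs of sons of `t` and `r` are filled
by recursion, extended by zero, and added to `A`. -/
def mulTemp (K : Kernel) (B : BlockTree T) (X Y : HTwo T k) (t s r : T.Node)
    (A : LowRank (T.Idx t) (T.Idx r) k) : Counted (LowRank (T.Idx t) (T.Idx r) k) :=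
  if h : B.IsLeafTriple t s r then do
    let P ← lowRankProduct B X Y t s r
    lowRankAdd K A P.2
  else
    foldOver (T.sonsPlus t) A fun t' A => foldOver (T.sonsPlus r) A fun r' A => do
      let C ← foldOver (T.sonsPlus s) (⟨0, 0⟩ : LowRank (T.Idx t'.1) (T.Idx r'.1) k)
        fun s' C => mulTemp K B X Y t'.1 s'.1 r'.1 C
      lowRankAdd K A (C.extend t r)
termination_by (T.depth - T.level t) + (T.depth - T.level s) + (T.depth - T.level r)
decreasing_by exact BlockTree.rem_triple_lt h t'.2 s'.2 r'.2

open scoped Classical in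
/-- The update `Z|_{t × r} ← Z|_{t × r} + X|_{t × s} * Y|_{s × r}` for a block `(t, r)` of an
`ℋ²`-matrix `Z`. If both factors are subdivided but `(t, r)` is an admissible leaf, temporary
matrices for the pairs of sons of `t` and `r` are filled by recursion, extended by
zero, and added to `Z|_{t × r}`. (If `(t, r)` is an inadmissible leaf, `t` and `r` have no
sons, and the recursion leaves the target block unchanged.) -/
def mulUpdate (K : Kernel) (B : BlockTree T) (X Y : HTwo T k) (t s r : T.Node)
    (Z : Target T k) : Counted (Target T k) :=
  if h : B.IsLeafTriple t s r then do
    let P ← lowRankProduct B X Y t s r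
    lowRankUpdate K B Z t r P.2
  else if (t, r) ∈ B.adm then
    foldOver (T.sonsPlus t) Z fun t' Z => foldOver (T.sonsPlus r) Z fun r' Z => do
      let C ← foldOver (T.sonsPlus s) (⟨0, 0⟩ : LowRank (T.Idx t'.1) (T.Idx r'.1) k)
        fun s' C => mulTemp K B X Y t'.1 s'.1 r'.1 C
      lowRankUpdate K B Z t r (C.extend t r)
  else
    foldOver (T.sonsPlus t) Z fun t' Z => foldOver (T.sonsPlus r) Z fun r' Z =>
      foldOver (T.sonsPlus s) Z fun s' Z => mulUpdate K B X Y t'.1 s'.1 r'.1 Z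
termination_by (T.depth - T.level t) + (T.depth - T.level s) + (T.depth - T.level r)
decreasing_by exact BlockTree.rem_triple_lt h t'.2 s'.2 r'.2

/-- The number `W_mm(t, s, r)` of operations required (in the worst case) to perform the update
`Z|_{t × r} ← Z|_{t × r} + X|_{t × s} * Y|_{s × r}`, where `Z|_{t × r}` is a block of an
`ℋ²`-matrix or a temporary matrix. -/
def mulCost (K : Kernel) (B : BlockTree T) (k : ℕ) (t s r : T.Node) : ℝ≥0∞ :=
  (⨆ (X : HTwo T k) (Y : HTwo T k) (Z : Target T k) (_ : (t, r) ∈ B.blocks),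
      ((mulUpdate K B X Y t s r Z).ops : ℝ≥0∞)) ⊔
    ⨆ (X : HTwo T k) (Y : HTwo T k) (A : LowRank (T.Idx t) (T.Idx r) k),
      ((mulTemp K B X Y t s r A).ops : ℝ≥0∞)

/-- `#t + #s + #r`, the sum of the cardinalities of three clusters. -/
def tripleSize (t s r : T.Node) : ℕ :=
  (T.label t).card + (T.label s).card + (T.label r).card

/-- `C` bounds the work for the multiplication in the sense that
`W_mm(t, s, r) ≤ C k² (#t + #s + #r)` if `(t, s)` or `(s, r)` is a leaf, and
`W_mm(t, s, r) ≤ C k² (#t + #s + #r) + ∑ W_mm(t', s', r')` with a sum over the sons otherwise. -/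
def IsMulBound (K : Kernel) (B : BlockTree T) (k : ℕ) (C : ℝ≥0) : Prop :=
  ∀ t s r : T.Node, (t, s) ∈ B.blocks → (s, r) ∈ B.blocks →
    (B.IsLeafTriple t s r →
      mulCost K B k t s r ≤ C * k ^ 2 * (tripleSize t s r : ℝ≥0∞)) ∧
    (¬ B.IsLeafTriple t s r →
      mulCost K B k t s r ≤ C * k ^ 2 * (tripleSize t s r : ℝ≥0∞) +
        ∑ t' ∈ T.sonsPlus t, ∑ s' ∈ T.sonsPlus s, ∑ r' ∈ T.sonsPlus r,
          mulCost K B k t' s' r')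

end H2Mult

end

noncomputable section

namespace H2Mult

/-! ### Operation counts of the elementary constructions -/

namespace Counted

variable {α β : Type}

/-! The first part bounds the work of one recursion step. The cost of a dense operation depends only
on the dimensions of its operands. Choose `N` as a fixed multiple of `k`, large enough for leaf
clusters, for bases extended by a low-rank factor, and for the stacked matrices in the QR
factorizations. In the sweeps through the cluster trees every operation then costs at most `K.unit
N`, a multiple of `k³`, and by sparsity there is a bounded number of operations per cluster. Since
`k³ #subtree ≤ Ctree k² #label`, a complete sweep costs `O(k² #label)`. The only operations with an
unbounded dimension have one row or column per index of a whole cluster, and the other two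
dimensions are at most `N`; they cost `O(k²)` per index. A step performs one low-rank product and
one addition if a factor is a leaf, and at most four additions besides the recursive calls otherwise
(`mulCost_le_of_isLeafTriple`, `mulCost_le_of_not_isLeafTriple`, combined in
`isMulBound_stepConst`).

The second part uses only the recursive inequality. Unrolling it bounds the cost for a triple by `C
k²` times the sum of `#t + #s + #r` over all descendants in the triple tree
(`mulCost_le_sum_descendants`). In each descendant, `(t, s)` and `(s, r)` are blocks. If one of the
three clusters is fixed, the other two are therefore reached by walking through two blocks, which
leaves at most `Csp²` choices (`card_pairs_le`). Hence each cluster of a subtree is counted at most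
`Csp²` times in each position. Clusters on the same level have disjoint labels, so the label sizes
in a subtree add up to at most `depth + 1` times the size of its root (`sum_card_label_subtree_le`).
-/

theorem ops_bind (x : Counted α) (f : α → Counted β) :
    (x >>= f).ops = x.ops + (f x.val).ops := rfl

theorem ops_pure (a : α) : (pure a : Counted α).ops = 0 := rfl

theorem val_bind (x : Counted α) (f : α → Counted β) : (x >>= f).val = (f x.val).val := rfl

theorem val_pure (a : α) : (pure a : Counted α).val = a := rfl

end Counted

open Counted

theorem forAll_ops_le {ι : Type} [Fintype ι] {β : ι → Type} {f : ∀ i, Counted (β i)} {M : ℕ}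
    (h : ∀ i, (f i).ops ≤ M) : (forAll f).ops ≤ Fintype.card ι * M :=
  Finset.sum_le_card_nsmul Finset.univ (fun i => (f i).ops) M fun i _ => h i

theorem forEach_ops_le {ι : Type} {s : Finset ι} {β : ι → Type} {old : ∀ i, β i}
    {f : ∀ i, Counted (β i)} {M : ℕ} (h : ∀ i ∈ s, (f i).ops ≤ M) :
    (forEach s old f).ops ≤ s.card * M :=
  Finset.sum_le_card_nsmul s (fun i => (f i).ops) M h

section Dense

variable {ι m n p : Type} [Fintype ι] [Fintype m] [Fintype n] [Fintype p]

theorem sumC_ops_le {f : ι → Counted (Matrix m n ℝ)} {M : ℕ} (h : ∀ i, (f i).ops ≤ M)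
    (hmn : Fintype.card m * Fintype.card n ≤ M) : (sumC f).ops ≤ Fintype.card ι * (2 * M) := by
  have h1 : ∑ i, (f i).ops ≤ Fintype.card ι * M := by
    simpa using Finset.sum_le_card_nsmul Finset.univ (fun i => (f i).ops) M fun i _ => h i
  have h2 := Nat.mul_le_mul_left (Fintype.card ι) hmn
  change ∑ i, (f i).ops + _ ≤ _
  linarith

/-- An upper bound for the number of operations per entry-triple of a dense operation. -/
def Kernel.weight (K : Kernel) : ℕ := 2 + K.qrConst + K.svdConst

/-- The bounds for tall and wide operands keep one dimension explicit. They serve for matrices with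
a row or column for each index of an arbitrary cluster, where the cost has to be quadratic in `N`
and linear in the size of the cluster. -/
theorem mulC_ops_le_tall (K : Kernel) {N : ℕ} (A : Matrix m n ℝ) (B : Matrix n p ℝ)
    (hn : Fintype.card n ≤ N) (hp : Fintype.card p ≤ N) :
    (mulC A B).ops ≤ K.weight * N ^ 2 * Fintype.card m := by
  calc 2 * Fintype.card m * Fintype.card n * Fintype.card p
      ≤ 2 * Fintype.card m * N * N := by gcongr
    _ = 2 * N ^ 2 * Fintype.card m := by ring
    _ ≤ _ := by gcongr; unfold Kernel.weight; omega

theorem mulC_ops_le_wide (K : Kernel) {N : ℕ} (A : Matrix m n ℝ) (B : Matrix n p ℝ)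
    (hm : Fintype.card m ≤ N) (hp : Fintype.card p ≤ N) :
    (mulC A B).ops ≤ K.weight * N ^ 2 * Fintype.card n := by
  calc 2 * Fintype.card m * Fintype.card n * Fintype.card p
      ≤ 2 * N * Fintype.card n * N := by gcongr
    _ = 2 * N ^ 2 * Fintype.card n := by ring
    _ ≤ _ := by gcongr; unfold Kernel.weight; omega

theorem qrC_ops_le_tall (K : Kernel) {N : ℕ} (A : Matrix m n ℝ) (hn : Fintype.card n ≤ N) :
    (K.qrC A).ops ≤ K.weight * N ^ 2 * Fintype.card m := by
  calc K.qrConst * (Fintype.card m * Fintype.card n * min (Fintype.card m) (Fintype.card n))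
      ≤ K.qrConst * (Fintype.card m * N * N) := by
        gcongr; exact (min_le_right _ _).trans hn
    _ = K.qrConst * N ^ 2 * Fintype.card m := by ring
    _ ≤ _ := by gcongr; unfold Kernel.weight; omega

theorem leadC_ops_le_tall (K : Kernel) {N : ℕ} (k : ℕ) (A : Matrix m n ℝ)
    (hn : Fintype.card n ≤ N) :
    (K.leadC k A).ops ≤ K.weight * N ^ 2 * Fintype.card m := by
  calc K.svdConst * (Fintype.card m * Fintype.card n * min (Fintype.card m) (Fintype.card n))
      ≤ K.svdConst * (Fintype.card m * N * N) := by
        gcongr; exact (min_le_right _ _).trans hn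
    _ = K.svdConst * N ^ 2 * Fintype.card m := by ring
    _ ≤ _ := by gcongr; unfold Kernel.weight; omega

/-- A bound for the cost of each dense operation on matrices with dimensions at most `N`. -/
def Kernel.unit (K : Kernel) (N : ℕ) : ℕ := K.weight * N ^ 3

theorem Kernel.tall_le_unit (K : Kernel) {N c : ℕ} (hc : c ≤ N) :
    K.weight * N ^ 2 * c ≤ K.unit N :=
  calc K.weight * N ^ 2 * c ≤ K.weight * N ^ 2 * N := by gcongr
    _ = K.unit N := by unfold Kernel.unit; ring

theorem mulC_ops_le (K : Kernel) {N : ℕ} (A : Matrix m n ℝ) (B : Matrix n p ℝ)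
    (hm : Fintype.card m ≤ N) (hn : Fintype.card n ≤ N) (hp : Fintype.card p ≤ N) :
    (mulC A B).ops ≤ K.unit N :=
  (mulC_ops_le_tall K A B hn hp).trans (K.tall_le_unit hm)

theorem qrC_ops_le (K : Kernel) {N : ℕ} (A : Matrix m n ℝ)
    (hm : Fintype.card m ≤ N) (hn : Fintype.card n ≤ N) : (K.qrC A).ops ≤ K.unit N :=
  (qrC_ops_le_tall K A hn).trans (K.tall_le_unit hm)

theorem leadC_ops_le (K : Kernel) {N : ℕ} (k : ℕ) (A : Matrix m n ℝ)
    (hm : Fintype.card m ≤ N) (hn : Fintype.card n ≤ N) : (K.leadC k A).ops ≤ K.unit N :=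
  (leadC_ops_le_tall K k A hn).trans (K.tall_le_unit hm)

theorem mul_le_unit (K : Kernel) {N a b : ℕ} (ha : a ≤ N) (hb : b ≤ N) :
    a * b ≤ K.unit N := by
  rcases Nat.eq_zero_or_pos N with rfl | hN
  · simp [Nat.le_zero.1 ha]
  calc a * b ≤ N * N := by gcongr
    _ = 1 * N ^ 2 * 1 := by ring
    _ ≤ K.weight * N ^ 2 * N := by
      gcongr
      · unfold Kernel.weight; omega
      · exact hN
    _ = K.unit N := by unfold Kernel.unit; ring

theorem addC_ops_le (K : Kernel) {N : ℕ} (A B : Matrix m n ℝ)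
    (hm : Fintype.card m ≤ N) (hn : Fintype.card n ≤ N) : (addC A B).ops ≤ K.unit N :=
  mul_le_unit K hm hn

end Dense

/-! ### Sweeps -/

namespace ClusterTree

variable {I : Type} [Fintype I] [DecidableEq I] {T : ClusterTree I}

theorem mem_subtree {t u : T.Node} :
    u ∈ T.subtree t ↔ Relation.ReflTransGen (fun a b => T.father b = some a) t u := by
  simp [subtree]

theorem self_mem_subtree (t : T.Node) : t ∈ T.subtree t := mem_subtree.2 .refl

theorem card_subtree_pos (t : T.Node) : 1 ≤ (T.subtree t).card :=
  Finset.card_pos.2 ⟨t, self_mem_subtree t⟩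

theorem sons_eq_empty_of_mem_leavesOf {t u : T.Node} (h : u ∈ T.leavesOf t) : T.sons u = ∅ :=
  (Finset.mem_filter.1 h).2

theorem card_leavesOf_le (t : T.Node) : (T.leavesOf t).card ≤ (T.subtree t).card :=
  Finset.card_filter_le _ _

/-- The bound on a step is required for all inputs `ih`, not only the computed ones. This suffices
because costs depend on dimensions and not on entries. -/
theorem sweepUp_ops_le {α : T.Node → Type} {t₀ : T.Node} {old : ∀ t, α t}
    {step : ∀ t, (∀ u : {u // u ∈ T.sons t}, α u) → Counted (α t)} {M : ℕ}
    (h : ∀ t ih, (step t ih).ops ≤ M) :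
    (T.sweepUp t₀ old step).ops ≤ (T.subtree t₀).card * M :=
  Finset.sum_le_card_nsmul (T.subtree t₀)
    (fun t => (step t (fun u => T.upVal step u.1)).ops) M fun t _ => h t _

theorem sweepDown_ops_le {α : Type} {t₀ : T.Node} {old : T.Node → α} {first : Counted α}
    {step : T.Node → α → Counted α} {M : ℕ} (h₀ : first.ops ≤ M)
    (h : ∀ t c, (step t c).ops ≤ M) :
    (T.sweepDown t₀ old first step).ops ≤ (T.subtree t₀).card * M := by
  classical
  have h1 : ∑ t ∈ (T.subtree t₀).erase t₀, (match T.father t with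
      | some a => (step t (T.downVal t₀ first step a)).ops
      | none => 0) ≤ ((T.subtree t₀).erase t₀).card * M := by
    rw [← smul_eq_mul]
    refine Finset.sum_le_card_nsmul _ _ _ fun t _ => ?_
    split
    · exact h _ _
    · exact Nat.zero_le _
  -- The root of the subtree is paid for by `h₀`, the remaining clusters by `h1`.
  have h2 := Finset.card_erase_add_one (self_mem_subtree t₀)
  rw [← h2, add_mul, one_mul, add_comm]
  refine le_trans (le_of_eq ?_) (add_le_add h₀ h1)
  unfold sweepDown
  congr!

end ClusterTree

/-! ### Costs of the building blocks of the algorithm -/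

variable {I : Type} [Fintype I] [DecidableEq I] {T : ClusterTree I}

/-- Leaf clusters have at most `N` indices, block rows and block columns contain at most
`P` blocks. -/
structure BlockTree.SizeBounds (B : BlockTree T) (N P : ℕ) : Prop where
  binary : ∀ t, (T.sons t).card ≤ 2
  leaf : ∀ t, T.sons t = ∅ → (T.label t).card ≤ N
  row : ∀ t, (Finset.univ.filter fun s => (t, s) ∈ B.blocks).card ≤ P
  col : ∀ s, (Finset.univ.filter fun t => (t, s) ∈ B.blocks).card ≤ P

theorem BlockTree.mem_inadm {B : BlockTree T} {b : T.Node × T.Node} :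
    b ∈ B.inadm ↔ (b ∈ B.blocks ∧ B.sons b = ∅) ∧ b ∉ B.adm := by
  simp [BlockTree.inadm, BlockTree.leaves]

theorem BlockTree.sons_eq_empty_of_mem_inadm {B : BlockTree T} {t s : T.Node}
    (h : (t, s) ∈ B.inadm) : T.sons t = ∅ ∧ T.sons s = ∅ := by
  rw [mem_inadm] at h
  exact B.leaf_of_inadm t s h.1.1 h.1.2 h.2

variable {k ρ N P : ℕ}

theorem Basis.expand_ops_le (K : Kernel) (b : Basis T k) (t₀ : T.Node) (hk : k ≤ N)
    (hleaf : ∀ t, T.sons t = ∅ → (T.label t).card ≤ N) :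
    (b.expand t₀).ops ≤ (T.subtree t₀).card * (2 * K.unit N) := by
  have h1 : (T.sweepDown t₀ (fun _ => (0 : Matrix (Fin k) (Fin k) ℝ)) (pure 1)
      (fun t c => mulC (b.transfer t) c)).ops ≤ (T.subtree t₀).card * K.unit N :=
    ClusterTree.sweepDown_ops_le (Nat.zero_le _) fun t c =>
      mulC_ops_le K _ _ (by simpa) (by simpa) (by simpa)
  have h2 (c : T.Node → Matrix (Fin k) (Fin k) ℝ) :
      (forEach (T.leavesOf t₀) (fun _ => 0) (fun t => mulC (b.leafMat t) (c t))).ops ≤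
        (T.subtree t₀).card * K.unit N :=
    (forEach_ops_le fun t ht => mulC_ops_le K _ _
      (by simpa using hleaf t (ClusterTree.sons_eq_empty_of_mem_leavesOf ht))
      (by simpa) (by simpa)).trans (Nat.mul_le_mul_right _ (ClusterTree.card_leavesOf_le t₀))
  simp only [Basis.expand, ops_bind, ops_pure]
  have := h2 (T.sweepDown t₀ (fun _ => (0 : Matrix (Fin k) (Fin k) ℝ)) (pure 1)
      (fun t c => mulC (b.transfer t) c)).val
  linarith

/-- A cluster below `s₀` costs `4 U`: up to two sons, each with a product and an accumulation, where
a term of `sumC` costs at most `2 U`. A cluster below `t₀` costs `2 P U` for coupling, `2 U` for the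
backward transformation and `(2 P + 2) U` in a leaf, together `(4 P + 4) U`. -/
theorem HTwo.mulSub_ops_le {κ : Type} [Fintype κ] (K : Kernel) (X : HTwo T k)
    (far near : Finset (T.Node × T.Node)) (t₀ s₀ : T.Node) (x : Matrix (T.Idx s₀) κ ℝ)
    (hk : k ≤ N) (hκ : Fintype.card κ ≤ N) (hbin : ∀ t, (T.sons t).card ≤ 2)
    (hleaf : ∀ t, T.sons t = ∅ → (T.label t).card ≤ N)
    (hfar : ∀ t, (Finset.univ.filter fun s => (t, s) ∈ far).card ≤ P)
    (hnear : ∀ t, (Finset.univ.filter fun s => (t, s) ∈ near).card ≤ P)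
    (hnear' : ∀ t s, (t, s) ∈ near → T.sons s = ∅) :
    (X.mulSub far near t₀ s₀ x).ops ≤
      ((T.subtree s₀).card + (T.subtree t₀).card) * ((4 * P + 4) * K.unit N) := by
  have hfilter (S : Finset T.Node) (f : Finset (T.Node × T.Node)) (t : T.Node)
      (hf : (Finset.univ.filter fun s => (t, s) ∈ f).card ≤ P) [DecidablePred fun s => (t, s) ∈ f] :
      Fintype.card {s // s ∈ S.filter fun s => (t, s) ∈ f} ≤ P := by
    rw [Fintype.card_coe]
    refine (Finset.card_le_card ?_).trans hf
    intro s hs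
    simpa using (Finset.mem_filter.1 hs).2
  simp only [HTwo.mulSub, ops_bind, ops_pure]
  set U := K.unit N with hU
  -- The summands are replaced by variables so that only linear arithmetic remains; the final `0` is
  -- the cost of `pure`.
  have key {a b c d : ℕ} (ha : a ≤ (T.subtree s₀).card * (4 * U))
      (hb : b ≤ (T.subtree t₀).card * (P * (2 * U)))
      (hc : c ≤ (T.subtree t₀).card * (2 * U))
      (hd : d ≤ (T.subtree t₀).card * (U + P * (2 * U) + U)) :
      a + (b + (c + (d + 0))) ≤
        ((T.subtree s₀).card + (T.subtree t₀).card) * ((4 * P + 4) * U) := by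
    have : 0 ≤ (T.subtree s₀).card * (P * U) := Nat.zero_le _
    linarith
  refine key ?_ ?_ ?_ ?_
  · refine ClusterTree.sweepUp_ops_le fun s ih => ?_
    split_ifs with h
    · refine (mulC_ops_le K _ _ (by simpa) (by simpa using hleaf s h) hκ).trans ?_
      linarith
    · refine (sumC_ops_le (M := U) (fun u => mulC_ops_le K _ _ (by simpa) (by simpa) hκ)
        (mul_le_unit K (by simpa) hκ)).trans ?_
      have : Fintype.card {u // u ∈ T.sons s} ≤ 2 := by simpa using hbin s
      calc _ ≤ 2 * (2 * U) := by gcongr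
        _ = 4 * U := by ring
  · refine (forEach_ops_le (M := P * (2 * U)) fun t _ => ?_)
    refine (sumC_ops_le (M := U) (fun u => mulC_ops_le K _ _ (by simpa) (by simpa) hκ)
        (mul_le_unit K (by simpa) hκ)).trans ?_
    exact Nat.mul_le_mul_right _ (hfilter _ _ _ (hfar t))
  · refine ClusterTree.sweepDown_ops_le (Nat.zero_le _) fun t c => ?_
    rw [ops_bind, two_mul]
    exact add_le_add (mulC_ops_le K _ _ (by simpa) (by simpa) hκ)
      (addC_ops_le K _ _ (by simpa) hκ)
  · refine (forEach_ops_le (M := U + P * (2 * U) + U) fun t ht => ?_).trans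
      (Nat.mul_le_mul_right _ (ClusterTree.card_leavesOf_le t₀))
    have ht' := hleaf t (ClusterTree.sons_eq_empty_of_mem_leavesOf ht)
    simp only [ops_bind, add_assoc]
    refine add_le_add (mulC_ops_le K _ _ (by simpa) (by simpa) hκ) (add_le_add ?_
      (addC_ops_le K _ _ (by simpa) hκ))
    refine (sumC_ops_le (M := U) (fun s => mulC_ops_le K _ _ (by simpa) ?_ hκ)
      (mul_le_unit K (by simpa) hκ)).trans ?_
    · simpa using hleaf s.1 (hnear' t s.1 (Finset.mem_filter.1 s.2).2)
    · exact Nat.mul_le_mul_right _ (hfilter _ _ _ (hnear t))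

/-! ### Extension, weights and truncation of a cluster basis -/

namespace WeightedBasis

variable (K : Kernel) (b : WeightedBasis T k) (t₀ : T.Node) (X : Matrix (T.Idx t₀) (Fin ρ) ℝ)

theorem extFactors_ops_le (hN : 2 * (k + ρ) ≤ N) (hbin : ∀ t, (T.sons t).card ≤ 2)
    (hleaf : ∀ t, T.sons t = ∅ → (T.label t).card ≤ N) :
    (b.extFactors K t₀ X).ops ≤ (T.subtree t₀).card * (3 * K.unit N) := by
  refine ClusterTree.sweepUp_ops_le fun t ih => ?_
  have hn : Fintype.card (Fin k ⊕ Fin ρ) ≤ N := by simp; omega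
  split_ifs with h
  · refine (qrC_ops_le K _ (by simpa using hleaf t h) hn).trans ?_
    linarith
  · have h2 : Fintype.card {u // u ∈ T.sons t} ≤ 2 := by simpa using hbin t
    rw [ops_bind]
    have h3 := (forAll_ops_le (f := fun u : {u // u ∈ T.sons t} =>
      mulC (ih u) (b.extTransfer ρ u.1)) fun u => mulC_ops_le K _ _ hn hn hn).trans
      (Nat.mul_le_mul_right _ h2)
    have h4 : Fintype.card ({u // u ∈ T.sons t} × (Fin k ⊕ Fin ρ)) ≤ N := by
      rw [Fintype.card_prod]
      refine le_trans (Nat.mul_le_mul_right _ h2) ?_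
      simpa using hN
    have h5 := qrC_ops_le K (stack (forAll fun u : {u // u ∈ T.sons t} =>
      mulC (ih u) (b.extTransfer ρ u.1)).val) h4 hn
    linarith

/-- The matrix to be factorized consists of at most `P` blocks with `k + ρ` rows, one for each
connected cluster, and the contribution of the father with at most `k + ρ` further rows. This
determines the size of `N`; the factor `P + 2` instead of `P + 1` also makes room for two stacked
sons when `P = 0`. -/
theorem extWeights_ops_le
    (opp : T.Node → Matrix (Fin k ⊕ Fin ρ) (Fin k ⊕ Fin ρ) ℝ)
    (S : T.Node → T.Node → Matrix (Fin k ⊕ Fin ρ) (Fin k ⊕ Fin ρ) ℝ)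
    (conn : T.Node → Finset T.Node) (hN : (P + 2) * (k + ρ) ≤ N)
    (hconn : ∀ t, (conn t).card ≤ P) :
    (b.extWeights K t₀ opp S conn).ops ≤ (T.subtree t₀).card * ((P + 2) * K.unit N) := by
  have hkρ : k + ρ ≤ N := le_trans (Nat.le_mul_of_pos_left _ (by omega)) hN
  have hk : Fintype.card (Fin k) ≤ N := by simp; omega
  have hn : Fintype.card (Fin k ⊕ Fin ρ) ≤ N := by simpa using hkρ
  have hM (t : T.Node) : (forAll fun s : {s // s ∈ conn t} => mulC (opp s.1) (S t s.1)ᵀ).ops ≤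
      P * K.unit N :=
    (forAll_ops_le fun u => mulC_ops_le K _ _ hn hn hn).trans
      (Nat.mul_le_mul_right _ (by simpa using hconn t))
  have hrows {m : Type} [Fintype m] (t : T.Node) (hm : Fintype.card m ≤ k + ρ) :
      Fintype.card (({s // s ∈ conn t} × (Fin k ⊕ Fin ρ)) ⊕ m) ≤ N := by
    rw [Fintype.card_sum, Fintype.card_prod]
    have h1 : Fintype.card {s // s ∈ conn t} ≤ P := by simpa using hconn t
    have h2 : Fintype.card (Fin k ⊕ Fin ρ) = k + ρ := by simp
    rw [h2]
    have := Nat.mul_le_mul_right (k + ρ) h1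
    linarith
  refine ClusterTree.sweepDown_ops_le ?_ fun t c => ?_
  · have key {a b c : ℕ} (ha : a ≤ P * K.unit N) (hb : b ≤ K.unit N) (hc : c ≤ K.unit N) :
        a + (b + c) ≤ (P + 2) * K.unit N := by linarith
    split <;> simp only [ops_bind]
    · exact key (hM _) (mulC_ops_le K _ _ hk hk hn) (qrC_ops_le K _ (hrows _ (by simp)) hn)
    · exact key (hM _) (Nat.zero_le _) (qrC_ops_le K _ (hrows _ (by simp)) hn)
  · simp only [ops_bind]
    have h1 := hM t
    have h2 := mulC_ops_le K c (b.extTransfer ρ t)ᵀ hn hn hn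
    have h3 := qrC_ops_le K (Matrix.fromRows (stack (forAll fun s : {s // s ∈ conn t} =>
      mulC (opp s.1) (S t s.1)ᵀ).val) (mulC c (b.extTransfer ρ t)ᵀ).val)
      (hrows t (by simp)) hn
    linarith

theorem truncate_ops_le (w : T.Node → Matrix (Fin k ⊕ Fin ρ) (Fin k ⊕ Fin ρ) ℝ)
    (hN : 2 * (k + ρ) ≤ N) (hbin : ∀ t, (T.sons t).card ≤ 2)
    (hleaf : ∀ t, T.sons t = ∅ → (T.label t).card ≤ N) :
    (b.truncate K t₀ X w).ops ≤ (T.subtree t₀).card * (5 * K.unit N) := by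
  refine ClusterTree.sweepUp_ops_le fun t ih => ?_
  have hk : Fintype.card (Fin k) ≤ N := by simp; omega
  have hn : Fintype.card (Fin k ⊕ Fin ρ) ≤ N := by simp; omega
  split_ifs with h
  · have ht : Fintype.card (T.Idx t) ≤ N := by simpa using hleaf t h
    have key {a b c : ℕ} (ha : a ≤ K.unit N) (hb : b ≤ K.unit N) (hc : c ≤ K.unit N) :
        a + (b + (c + 0)) ≤ 5 * K.unit N := by linarith
    simp only [ops_bind, ops_pure]
    exact key (mulC_ops_le K _ _ ht hn hn) (leadC_ops_le K _ _ ht hn)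
      (mulC_ops_le K _ _ hk ht hn)
  · have h2 : Fintype.card {u // u ∈ T.sons t} ≤ 2 := by simpa using hbin t
    have h3 := (forAll_ops_le (f := fun u : {u // u ∈ T.sons t} =>
      mulC (ih u).change (b.extTransfer ρ u.1)) fun u => mulC_ops_le K _ _ hk hn hn).trans
      (Nat.mul_le_mul_right _ h2)
    have h4 : Fintype.card ({u // u ∈ T.sons t} × Fin k) ≤ N := by
      rw [Fintype.card_prod]
      refine le_trans (Nat.mul_le_mul_right _ h2) ?_
      simp only [Fintype.card_fin]
      omega
    have key {a b c d : ℕ} (ha : a ≤ 2 * K.unit N) (hb : b ≤ K.unit N) (hc : c ≤ K.unit N)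
        (hd : d ≤ K.unit N) : a + (b + (c + (d + 0))) ≤ 5 * K.unit N := by linarith
    simp only [ops_bind, ops_pure]
    exact key h3 (mulC_ops_le K _ _ h4 hn hn) (leadC_ops_le K _ _ h4 hn)
      (mulC_ops_le K _ _ hk h4 hn)

theorem replace_ops_le (w : T.Node → Matrix (Fin k ⊕ Fin ρ) (Fin k ⊕ Fin ρ) ℝ)
    (q : ∀ t, Truncated T k ρ t) (hN : k + ρ ≤ N) :
    (b.replace K t₀ w q).ops ≤ (T.subtree t₀).card * (3 * K.unit N) := by
  have hk : Fintype.card (Fin k) ≤ N := by simp; omega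
  have hn : Fintype.card (Fin k ⊕ Fin ρ) ≤ N := by simpa using hN
  -- The single product for the adapted transfer matrix in `t₀` is charged to the subtree, which has
  -- at least one node.
  have key {a b : ℕ} (ha : a ≤ K.unit N) (hb : b ≤ (T.subtree t₀).card * (2 * K.unit N)) :
      a + (b + 0) ≤ (T.subtree t₀).card * (3 * K.unit N) := by
    have := Nat.mul_le_mul_right (K.unit N) (ClusterTree.card_subtree_pos t₀)
    linarith
  simp only [replace, ops_bind, ops_pure]
  refine key (mulC_ops_le K _ _ hk hn hk) (forEach_ops_le fun t _ => ?_)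
  rw [ops_bind, two_mul]
  exact add_le_add (mulC_ops_le K _ _ hn hn hk) (qrC_ops_le K _ hn hk)

end WeightedBasis

/-! ### Counting the blocks connected to a set of clusters -/

namespace BlockTree.SizeBounds

variable {B : BlockTree T}

theorem card_filter_fst (hB : B.SizeBounds N P) (S : Finset T.Node) (f : Finset (T.Node × T.Node))
    (hf : f ⊆ B.blocks) (hS : ∀ b ∈ f, b.1 ∈ S) : f.card ≤ S.card * P := by
  classical
  rw [mul_comm]
  refine Finset.card_le_mul_card_image_of_maps_to (f := Prod.fst) hS P fun t _ => ?_
  refine le_trans ?_ (hB.row t)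
  refine Finset.card_le_card_of_injOn Prod.snd ?_ ?_
  · rintro ⟨a, s⟩ h
    have h' := Finset.mem_filter.1 (Finset.mem_coe.1 h)
    obtain ⟨h1, rfl⟩ := h'
    simpa using hf h1
  · rintro ⟨a, s⟩ h ⟨a', s'⟩ h' e
    have h1 := (Finset.mem_filter.1 h).2
    have h2 := (Finset.mem_filter.1 h').2
    simp only at h1 h2 e
    rw [h1, h2, e]

theorem card_filter_snd (hB : B.SizeBounds N P) (S : Finset T.Node) (f : Finset (T.Node × T.Node))
    (hf : f ⊆ B.blocks) (hS : ∀ b ∈ f, b.2 ∈ S) : f.card ≤ S.card * P := by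
  classical
  rw [mul_comm]
  refine Finset.card_le_mul_card_image_of_maps_to (f := Prod.snd) hS P fun t _ => ?_
  refine le_trans ?_ (hB.col t)
  refine Finset.card_le_card_of_injOn Prod.fst ?_ ?_
  · rintro ⟨a, s⟩ h
    have h' := Finset.mem_filter.1 (Finset.mem_coe.1 h)
    obtain ⟨h1, rfl⟩ := h'
    simpa using hf h1
  · rintro ⟨a, s⟩ h ⟨a', s'⟩ h' e
    have h1 := (Finset.mem_filter.1 h).2
    have h2 := (Finset.mem_filter.1 h').2
    simp only at h1 h2 e
    rw [h1, h2, e]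

theorem card_row_le (hB : B.SizeBounds N P) {f : Finset (T.Node × T.Node)} (hf : f ⊆ B.blocks)
    (t : T.Node) : (Finset.univ.filter fun s => (t, s) ∈ f).card ≤ P :=
  (Finset.card_le_card fun s hs => by simpa using hf (Finset.mem_filter.1 hs).2).trans (hB.row t)

theorem card_col_le (hB : B.SizeBounds N P) {f : Finset (T.Node × T.Node)} (hf : f ⊆ B.blocks)
    (s : T.Node) : (Finset.univ.filter fun t => (t, s) ∈ f).card ≤ P :=
  (Finset.card_le_card fun s hs => by simpa using hf (Finset.mem_filter.1 hs).2).trans (hB.col s)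

end BlockTree.SizeBounds

theorem BlockTree.adm_subset_blocks (B : BlockTree T) : B.adm ⊆ B.blocks :=
  fun b hb => (B.adm_subset b hb).1

theorem BlockTree.inadm_subset_blocks (B : BlockTree T) : B.inadm ⊆ B.blocks :=
  fun _ hb => (BlockTree.mem_inadm.1 hb).1.1

theorem lowRankUpdate_ops_le (K : Kernel) {B : BlockTree T} (hB : B.SizeBounds N P)
    (Z : Target T k) (t₀ r₀ : T.Node) (A : LowRank (T.Idx t₀) (T.Idx r₀) ρ)
    (hN : (P + 2) * (k + ρ) ≤ N) :
    (lowRankUpdate K B Z t₀ r₀ A).ops ≤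
      ((T.subtree t₀).card + (T.subtree r₀).card) * ((5 * P + 13) * K.unit N) := by
  have hN2 : 2 * (k + ρ) ≤ N := le_trans (Nat.mul_le_mul_right _ (by omega)) hN
  have hk : Fintype.card (Fin k) ≤ N := by simp; omega
  have hρ : Fintype.card (Fin ρ) ≤ N := by simp; omega
  have hn : Fintype.card (Fin k ⊕ Fin ρ) ≤ N := by simp; omega
  -- Per cluster below `t₀`, in multiples of `K.unit N`: `3` for the factors, `P + 2` for the
  -- weights, `5` for the truncation, `3` for the replacement, `2 P` for coupling matrices and `2 P`
  -- for nearfield matrices, in total `5 P + 13`. Nearfield blocks are charged to their row clusters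
  -- only.
  have key {a b c d e f g h i j : ℕ}
      (ha : a ≤ (T.subtree t₀).card * (3 * K.unit N))
      (hb : b ≤ (T.subtree r₀).card * (3 * K.unit N))
      (hc : c ≤ (T.subtree t₀).card * ((P + 2) * K.unit N))
      (hd : d ≤ (T.subtree r₀).card * ((P + 2) * K.unit N))
      (he : e ≤ (T.subtree t₀).card * (5 * K.unit N))
      (hf : f ≤ (T.subtree r₀).card * (5 * K.unit N))
      (hg : g ≤ (T.subtree t₀).card * (3 * K.unit N))
      (hh : h ≤ (T.subtree r₀).card * (3 * K.unit N))
      (hi : i ≤ ((T.subtree t₀).card * P + (T.subtree r₀).card * P) * (2 * K.unit N))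
      (hj : j ≤ ((T.subtree t₀).card * P) * (2 * K.unit N)) :
      a + (b + (c + (d + (e + (f + (g + (h + (i + (j + 0))))))))) ≤
      ((T.subtree t₀).card + (T.subtree r₀).card) * ((5 * P + 13) * K.unit N) := by
    have : 0 ≤ (T.subtree t₀).card * P * K.unit N := Nat.zero_le _
    have : 0 ≤ (T.subtree r₀).card * P * K.unit N := Nat.zero_le _
    linarith
  simp only [lowRankUpdate, ops_bind, ops_pure]
  refine key (WeightedBasis.extFactors_ops_le K _ _ _ hN2 hB.binary hB.leaf)
    (WeightedBasis.extFactors_ops_le K _ _ _ hN2 hB.binary hB.leaf)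
    (WeightedBasis.extWeights_ops_le K _ _ _ _ _ hN (hB.card_row_le B.adm_subset_blocks))
    (WeightedBasis.extWeights_ops_le K _ _ _ _ _ hN (hB.card_col_le B.adm_subset_blocks))
    (WeightedBasis.truncate_ops_le K _ _ _ _ hN2 hB.binary hB.leaf)
    (WeightedBasis.truncate_ops_le K _ _ _ _ hN2 hB.binary hB.leaf)
    (WeightedBasis.replace_ops_le K _ _ _ _ (by omega))
    (WeightedBasis.replace_ops_le K _ _ _ _ (by omega)) ?_ ?_
  · refine (forEach_ops_le (M := 2 * K.unit N) fun b _ => ?_).trans (Nat.mul_le_mul_right _ ?_)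
    · have hu : K.unit N ≤ 2 * K.unit N := by omega
      by_cases h1 : b.1 ∈ T.subtree t₀
      · rw [if_pos h1]
        by_cases h2 : b.2 ∈ T.subtree r₀
        · rw [if_pos h2, ops_bind, two_mul]
          exact add_le_add (mulC_ops_le K _ _ hk hn hn) (mulC_ops_le K _ _ hk hn hk)
        · rw [if_neg h2]
          exact (mulC_ops_le K _ _ hk hn hk).trans hu
      · rw [if_neg h1]
        exact (mulC_ops_le K _ _ hk hn hk).trans hu
    · classical
      rw [Finset.filter_or]
      refine (Finset.card_union_le _ _).trans (add_le_add ?_ ?_)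
      · exact hB.card_filter_fst _ _ ((Finset.filter_subset _ _).trans B.adm_subset_blocks)
          fun b hb => (Finset.mem_filter.1 hb).2
      · exact hB.card_filter_snd _ _ ((Finset.filter_subset _ _).trans B.adm_subset_blocks)
          fun b hb => (Finset.mem_filter.1 hb).2
  · refine (forEach_ops_le (M := 2 * K.unit N) fun b hb => ?_).trans (Nat.mul_le_mul_right _ ?_)
    · have hb' := BlockTree.sons_eq_empty_of_mem_inadm (Finset.mem_filter.1 hb).1
      have h1 : Fintype.card (T.Idx b.1) ≤ N := by simpa using hB.leaf _ hb'.1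
      have h2 : Fintype.card (T.Idx b.2) ≤ N := by simpa using hB.leaf _ hb'.2
      rw [ops_bind, two_mul]
      exact add_le_add (mulC_ops_le K _ _ h1 hρ h2) (addC_ops_le K _ _ h1 h2)
    · exact hB.card_filter_fst _ _ ((Finset.filter_subset _ _).trans B.inadm_subset_blocks)
          fun b hb => (Finset.mem_filter.1 hb).2.1

theorem lowRankAdd_ops_le {m n : Type} [Fintype m] [Fintype n] (K : Kernel) (A : LowRank m n k)
    (A' : LowRank m n ρ) (hN : k + ρ ≤ N) :
    (lowRankAdd K A A').ops ≤ 5 * (K.weight * N ^ 2 * (Fintype.card m + Fintype.card n)) := by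
  have hk : Fintype.card (Fin k) ≤ N := by simp; omega
  have hn : Fintype.card (Fin k ⊕ Fin ρ) ≤ N := by simpa using hN
  have key {a b c d e : ℕ} (ha : a ≤ K.weight * N ^ 2 * Fintype.card n)
      (hb : b ≤ K.weight * N ^ 2 * Fintype.card m) (hc : c ≤ K.weight * N ^ 2 * Fintype.card m)
      (hd : d ≤ K.weight * N ^ 2 * Fintype.card m) (he : e ≤ K.weight * N ^ 2 * Fintype.card n) :
      a + (b + (c + (d + (e + 0)))) ≤
        5 * (K.weight * N ^ 2 * (Fintype.card m + Fintype.card n)) := by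
    have : 0 ≤ K.weight * N ^ 2 * Fintype.card n := Nat.zero_le _
    have : 0 ≤ K.weight * N ^ 2 * Fintype.card m := Nat.zero_le _
    linarith
  simp only [lowRankAdd, ops_bind, ops_pure]
  exact key (qrC_ops_le_tall K _ hn) (mulC_ops_le_tall K _ _ hn hn) (leadC_ops_le_tall K _ _ hn)
    (mulC_ops_le_wide K _ _ hk hn) (mulC_ops_le_tall K _ _ hn hk)

/-! ### Costs of one step of the multiplication -/

theorem BlockTree.mem_adm_or_mem_inadm {B : BlockTree T} {b : T.Node × T.Node} (hb : b ∈ B.blocks)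
    (h : B.sons b = ∅) : b ∈ B.adm ∨ b ∈ B.inadm := by
  rw [mem_inadm]
  tauto

/-- The leaf among the two factors that is chosen in `lowRankProduct`. -/
theorem BlockTree.IsLeafTriple.mem_inadm {B : BlockTree T} {t s r : T.Node}
    (h : B.IsLeafTriple t s r) (hts : (t, s) ∈ B.blocks) (hsr : (s, r) ∈ B.blocks)
    (h1 : (s, r) ∉ B.adm) (h2 : (s, r) ∉ B.inadm) (h3 : (t, s) ∉ B.adm) :
    (t, s) ∈ B.inadm := by
  refine (BlockTree.mem_adm_or_mem_inadm hts ?_).resolve_left h3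
  rcases h with h | h
  · exact h
  · rcases BlockTree.mem_adm_or_mem_inadm hsr h with h | h <;> contradiction

/-- An admissible leaf has rank `k`. The factorization of an inadmissible leaf contains an identity
whose size is that of a leaf cluster. -/
theorem lowRankProduct_rank_le {B : BlockTree T} (X Y : HTwo T k) {t s r : T.Node}
    (h : B.IsLeafTriple t s r) (hts : (t, s) ∈ B.blocks) (hsr : (s, r) ∈ B.blocks) {M : ℕ}
    (hk : k ≤ M) (hleaf : ∀ t, T.sons t = ∅ → (T.label t).card ≤ M) :
    (lowRankProduct B X Y t s r).val.1 ≤ M := by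
  unfold lowRankProduct
  split_ifs with h1 h2 h3 <;> simp only [val_bind, val_pure]
  · exact hk
  · simpa using hleaf r (BlockTree.sons_eq_empty_of_mem_inadm h2).2
  · exact hk
  · simpa using hleaf t (BlockTree.sons_eq_empty_of_mem_inadm (h.mem_inadm hts hsr h1 h2 h3)).1

/-- The number of nodes in the subtrees of three clusters. -/
def tripleNodes (t s r : T.Node) : ℕ :=
  (T.subtree t).card + (T.subtree s).card + (T.subtree r).card

/-- The term with `tripleSize` comes from the product with the coupling matrix of an admissible
leaf, which has one row per index of `t` or `r`. All other work is done in sweeps and is bounded per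
cluster. -/
theorem lowRankProduct_ops_le (K : Kernel) {B : BlockTree T} (hB : B.SizeBounds N P)
    (X Y : HTwo T k) {t s r : T.Node} (h : B.IsLeafTriple t s r) (hts : (t, s) ∈ B.blocks)
    (hsr : (s, r) ∈ B.blocks) (hk : k ≤ N) :
    (lowRankProduct B X Y t s r).ops ≤ tripleNodes t s r * ((4 * P + 8) * K.unit N) +
      K.weight * N ^ 2 * tripleSize t s r := by
  have hfar {f : Finset (T.Node × T.Node)} (hf : f ⊆ B.blocks) (s : T.Node) :
      (Finset.univ.filter fun t => (s, t) ∈ f.image Prod.swap).card ≤ P := by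
    refine (Finset.card_le_card fun t ht => ?_).trans (hB.card_col_le hf s)
    simpa using ht
  have hX {κ : Type} [Fintype κ] (hκ : Fintype.card κ ≤ N) (x : Matrix (T.Idx s) κ ℝ) :
      (X.mulSub B.adm B.inadm t s x).ops ≤
        ((T.subtree s).card + (T.subtree t).card) * ((4 * P + 4) * K.unit N) :=
    X.mulSub_ops_le K _ _ t s x hk hκ hB.binary hB.leaf (hB.card_row_le B.adm_subset_blocks)
      (hB.card_row_le B.inadm_subset_blocks)
      fun _ _ h => (BlockTree.sons_eq_empty_of_mem_inadm h).2
  have hY {κ : Type} [Fintype κ] (hκ : Fintype.card κ ≤ N) (x : Matrix (T.Idx s) κ ℝ) :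
      (Y.transpose.mulSub (B.adm.image Prod.swap) (B.inadm.image Prod.swap) r s x).ops ≤
        ((T.subtree s).card + (T.subtree r).card) * ((4 * P + 4) * K.unit N) := by
    refine Y.transpose.mulSub_ops_le K _ _ r s x hk hκ hB.binary hB.leaf
      (hfar B.adm_subset_blocks) (hfar B.inadm_subset_blocks) fun t s h => ?_
    obtain ⟨⟨a, b⟩, hab, e⟩ := Finset.mem_image.1 h
    cases e
    exact (BlockTree.sons_eq_empty_of_mem_inadm hab).1
  have hk' : Fintype.card (Fin k) ≤ N := by simpa
  have w0 (n : ℕ) : 0 ≤ K.weight * N ^ 2 * n := Nat.zero_le _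
  have u0 (n : ℕ) : 0 ≤ n * P * K.unit N := Nat.zero_le _
  have u1 (n : ℕ) : 0 ≤ n * K.unit N := Nat.zero_le _
  have hXe {b : Basis T k} (t : T.Node) := b.expand_ops_le K t hk hB.leaf
  have kX {a b c d : ℕ} (ha : a ≤ (T.subtree s).card * (2 * K.unit N))
      (hb : b ≤ ((T.subtree s).card + (T.subtree t).card) * ((4 * P + 4) * K.unit N))
      (hc : c ≤ K.weight * N ^ 2 * (T.label t).card)
      (hd : d ≤ (T.subtree r).card * (2 * K.unit N)) :
      a + (b + (c + (d + 0))) ≤ tripleNodes t s r * ((4 * P + 8) * K.unit N) +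
        K.weight * N ^ 2 * tripleSize t s r := by
    unfold tripleNodes tripleSize
    linarith [w0 (T.label s).card, w0 (T.label r).card, u0 (T.subtree t).card,
      u0 (T.subtree s).card, u0 (T.subtree r).card, u1 (T.subtree t).card,
      u1 (T.subtree s).card, u1 (T.subtree r).card]
  have kY {a b c d : ℕ} (ha : a ≤ (T.subtree s).card * (2 * K.unit N))
      (hb : b ≤ ((T.subtree s).card + (T.subtree r).card) * ((4 * P + 4) * K.unit N))
      (hc : c ≤ K.weight * N ^ 2 * (T.label r).card)
      (hd : d ≤ (T.subtree t).card * (2 * K.unit N)) :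
      a + (b + (c + (d + 0))) ≤ tripleNodes t s r * ((4 * P + 8) * K.unit N) +
        K.weight * N ^ 2 * tripleSize t s r := by
    unfold tripleNodes tripleSize
    linarith [w0 (T.label s).card, w0 (T.label t).card, u0 (T.subtree t).card,
      u0 (T.subtree s).card, u0 (T.subtree r).card, u1 (T.subtree t).card,
      u1 (T.subtree s).card, u1 (T.subtree r).card]
  unfold lowRankProduct
  split_ifs with h1 h2 h3 <;> simp only [ops_bind, ops_pure]
  · exact kX (hXe s) (hX hk' _) ((mulC_ops_le_tall K _ _ hk' hk').trans_eq (by rw [Fintype.card_coe])) (hXe r)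
  · have hr : Fintype.card (T.Idx r) ≤ N := by
      simpa using hB.leaf r (BlockTree.sons_eq_empty_of_mem_inadm h2).2
    simpa using kX (Nat.zero_le _) (hX hr (Y.near s r)) (Nat.zero_le _) (Nat.zero_le _)
  · exact kY (hXe s) (hY hk' _) ((mulC_ops_le_tall K _ _ hk' hk').trans_eq (by rw [Fintype.card_coe])) (hXe t)
  · have ht : Fintype.card (T.Idx t) ≤ N := by
      simpa using hB.leaf t
        (BlockTree.sons_eq_empty_of_mem_inadm (h.mem_inadm hts hsr h1 h2 h3)).1
    simpa using kY (Nat.zero_le _) (hY ht (X.near t s)ᵀ) (Nat.zero_le _) (Nat.zero_le _)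

/-- A common bound for the cost per index of all operations apart from the recursive calls. -/
structure WorkBound (T : ClusterTree I) (K : Kernel) (N V : ℕ) : Prop where
  nodes : ∀ t : T.Node, (T.subtree t).card * K.unit N ≤ V * (T.label t).card
  index : K.weight * N ^ 2 ≤ V

theorem WorkBound.tripleNodes_le {K : Kernel} {V : ℕ} (hV : WorkBound T K N V) (t s r : T.Node) :
    tripleNodes t s r * K.unit N ≤ V * tripleSize t s r := by
  unfold tripleNodes tripleSize
  linarith [hV.nodes t, hV.nodes s, hV.nodes r]

theorem lowRankProduct_ops_le_size {K : Kernel} {V : ℕ} (hV : WorkBound T K N V)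
    {B : BlockTree T} (hB : B.SizeBounds N P)
    (X Y : HTwo T k) {t s r : T.Node} (h : B.IsLeafTriple t s r) (hts : (t, s) ∈ B.blocks)
    (hsr : (s, r) ∈ B.blocks) (hk : k ≤ N) :
    (lowRankProduct B X Y t s r).ops ≤ (4 * P + 9) * V * tripleSize t s r := by
  refine (lowRankProduct_ops_le K hB X Y h hts hsr hk).trans ?_
  have h1 := Nat.mul_le_mul_left (4 * P + 8) (hV.tripleNodes_le t s r)
  have h2 := Nat.mul_le_mul_right (tripleSize t s r) hV.index
  linarith

theorem lowRankUpdate_ops_le_size {K : Kernel} {V : ℕ} (hV : WorkBound T K N V)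
    {B : BlockTree T} (hB : B.SizeBounds N P) (Z : Target T k) {t r : T.Node} {ρ : ℕ}
    (A : LowRank (T.Idx t) (T.Idx r) ρ) (hN : (P + 2) * (k + ρ) ≤ N) (s : T.Node) :
    (lowRankUpdate K B Z t r A).ops ≤ (5 * P + 13) * V * tripleSize t s r := by
  refine (lowRankUpdate_ops_le K hB Z t r A hN).trans ?_
  have h1 := Nat.mul_le_mul_left (5 * P + 13) (hV.nodes t)
  have h2 := Nat.mul_le_mul_left (5 * P + 13) (hV.nodes r)
  have h3 : 0 ≤ (5 * P + 13) * V * (T.label s).card := Nat.zero_le _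
  unfold tripleSize
  linarith

theorem lowRankAdd_ops_le_size {K : Kernel} {V : ℕ} (hV : WorkBound T K N V) {t r : T.Node}
    {ρ : ℕ} (A : LowRank (T.Idx t) (T.Idx r) k) (A' : LowRank (T.Idx t) (T.Idx r) ρ)
    (hN : k + ρ ≤ N) (s : T.Node) :
    (lowRankAdd K A A').ops ≤ 5 * V * tripleSize t s r := by
  refine (lowRankAdd_ops_le K A A' hN).trans ?_
  have h1 := Nat.mul_le_mul_right ((T.label t).card + (T.label r).card) hV.index
  have h3 : 0 ≤ V * (T.label s).card := Nat.zero_le _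
  simp only [Fintype.card_coe]
  unfold tripleSize
  linarith

/-! ### The recursive inequality for one triple -/

theorem card_sonsPlus_le (hbin : ∀ t, (T.sons t).card ≤ 2) (t : T.Node) :
    (T.sonsPlus t).card ≤ 2 := by
  unfold ClusterTree.sonsPlus
  split_ifs
  · simp
  · exact hbin t

theorem BlockTree.sons_eq_sonsPlus {B : BlockTree T} {t s : T.Node} (h : B.sons (t, s) ≠ ∅) :
    B.sons (t, s) = T.sonsPlus t ×ˢ T.sonsPlus s := by
  have h0 := B.sons_eq t s h
  unfold ClusterTree.sonsPlus
  rw [h0] at h ⊢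
  -- If both clusters are leaves, the set of sons would be a product with `∅`, contrary to `h`.
  split_ifs at h ⊢ <;> simp_all

theorem mulTemp_ops_le_mulCost (K : Kernel) (B : BlockTree T) (X Y : HTwo T k) (t s r : T.Node)
    (A : LowRank (T.Idx t) (T.Idx r) k) :
    ((mulTemp K B X Y t s r A).ops : ℝ≥0∞) ≤ mulCost K B k t s r :=
  le_sup_of_le_right (le_iSup_of_le X (le_iSup_of_le Y
    (le_iSup (fun A => ((mulTemp K B X Y t s r A).ops : ℝ≥0∞)) A)))

theorem mulUpdate_ops_le_mulCost (K : Kernel) (B : BlockTree T) (X Y : HTwo T k) (t s r : T.Node)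
    (Z : Target T k) (h : (t, r) ∈ B.blocks) :
    ((mulUpdate K B X Y t s r Z).ops : ℝ≥0∞) ≤ mulCost K B k t s r :=
  le_sup_of_le_left (le_iSup_of_le X (le_iSup_of_le Y (le_iSup_of_le Z
    (le_iSup (fun _ : (t, r) ∈ B.blocks => ((mulUpdate K B X Y t s r Z).ops : ℝ≥0∞)) h))))

/-- The later steps work on an accumulated value that is not known. The bound `c i` is uniform in
this value, which is why the worst case over all targets in `mulCost` fits the sequential recursion.
-/
theorem foldOver_ops_le {ι β : Type} {s : Finset ι} {init : β}
    {f : {i // i ∈ s} → β → Counted β} (c : ι → ℝ≥0∞)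
    (hc : ∀ i b, ((f i b).ops : ℝ≥0∞) ≤ c i.1) :
    ((foldOver s init f).ops : ℝ≥0∞) ≤ ∑ i ∈ s, c i := by
  have key (l : List {i // i ∈ s}) (b : β) :
      (((l.foldlM (fun acc i => f i acc) b).ops : ℕ) : ℝ≥0∞) ≤ (l.map fun i => c i.1).sum := by
    induction l generalizing b with
    | nil => simp [ops_pure]
    | cons i l ih =>
      rw [List.foldlM_cons, ops_bind, List.map_cons, List.sum_cons, Nat.cast_add]
      exact add_le_add (hc i b) (ih _)
  refine (key _ _).trans ?_
  rw [Finset.sum_map_toList, Finset.sum_attach s c]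

/-- The recursion for the target being a temporary matrix or an admissible leaf: for all sons of
`t` and `r`, a temporary matrix is filled and added to the target. -/
theorem collect_ops_le (K : Kernel) {B : BlockTree T} (hB : B.SizeBounds N P) (X Y : HTwo T k)
    (t s r : T.Node) {β : Type} (init : β) {M : ℕ}
    (add : ∀ (t' r' : T.Node), LowRank (T.Idx t') (T.Idx r') k → β → Counted β)
    (hadd : ∀ t' r' C b, (add t' r' C b).ops ≤ M) :
    ((foldOver (T.sonsPlus t) init fun t' A => foldOver (T.sonsPlus r) A fun r' A => do
      let C ← foldOver (T.sonsPlus s) (⟨0, 0⟩ : LowRank (T.Idx t'.1) (T.Idx r'.1) k)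
        fun s' C => mulTemp K B X Y t'.1 s'.1 r'.1 C
      add t'.1 r'.1 C A).ops : ℝ≥0∞) ≤ 4 * (M : ℝ≥0∞) +
        ∑ t' ∈ T.sonsPlus t, ∑ s' ∈ T.sonsPlus s, ∑ r' ∈ T.sonsPlus r,
          mulCost K B k t' s' r' := by
  refine (foldOver_ops_le (fun t' => ∑ r' ∈ T.sonsPlus r,
    (∑ s' ∈ T.sonsPlus s, mulCost K B k t' s' r' + M)) fun t' A =>
    foldOver_ops_le (fun r' => ∑ s' ∈ T.sonsPlus s, mulCost K B k t' s' r' + M)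
    fun r' A => ?_).trans ?_
  · rw [ops_bind, Nat.cast_add]
    exact add_le_add (foldOver_ops_le (fun s' => mulCost K B k t' s' r')
      fun s' C => mulTemp_ops_le_mulCost K B X Y _ _ _ C) (Nat.cast_le.2 (hadd _ _ _ _))
  · simp only [Finset.sum_add_distrib, Finset.sum_const, nsmul_eq_mul]
    rw [add_comm, ← mul_assoc]
    refine add_le_add ?_ (le_of_eq (Finset.sum_congr rfl fun _ _ => Finset.sum_comm))
    gcongr
    -- There are at most `2 * 2` pairs of sons of `t` and `r`, hence at most four additions; the
    -- sons of `s` share one temporary matrix.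
    have h1 := Nat.mul_le_mul (card_sonsPlus_le hB.binary t) (card_sonsPlus_le hB.binary r)
    exact_mod_cast h1

/-- The product costs `4 P + 9` and the update `5 P + 13` multiples of `V * tripleSize t s r`. The
larger constant is chosen to agree with the subdivided case, where four updates cost `20 P + 52`. -/
theorem mulCost_le_of_isLeafTriple {K : Kernel} {V : ℕ} (hV : WorkBound T K N V)
    {B : BlockTree T} (hB : B.SizeBounds N P) {M : ℕ} (hk : k ≤ M)
    (hleaf : ∀ t, T.sons t = ∅ → (T.label t).card ≤ M) (hN : (P + 2) * (k + M) ≤ N)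
    {t s r : T.Node} (h : B.IsLeafTriple t s r) (hts : (t, s) ∈ B.blocks)
    (hsr : (s, r) ∈ B.blocks) :
    mulCost K B k t s r ≤ (((20 * P + 60) * V * tripleSize t s r : ℕ) : ℝ≥0∞) := by
  have hkM : k + M ≤ N := le_trans (Nat.le_mul_of_pos_left _ (by omega)) hN
  have hp (X Y : HTwo T k) := lowRankProduct_ops_le_size hV hB X Y h hts hsr (by omega)
  have hr (X Y : HTwo T k) := lowRankProduct_rank_le X Y h hts hsr hk hleaf
  have v0 : 0 ≤ P * V * tripleSize t s r := Nat.zero_le _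
  have v1 : 0 ≤ V * tripleSize t s r := Nat.zero_le _
  refine sup_le (iSup_le fun X => iSup_le fun Y => iSup_le fun Z => iSup_le fun _ => ?_)
    (iSup_le fun X => iSup_le fun Y => iSup_le fun A => ?_)
  · rw [mulUpdate, dif_pos h, Nat.cast_le, ops_bind]
    have h1 := lowRankUpdate_ops_le_size hV hB Z (lowRankProduct B X Y t s r).val.2
      ((Nat.mul_le_mul_left _ (Nat.add_le_add_left (hr X Y) k)).trans hN) s
    linarith [hp X Y]
  · rw [mulTemp, dif_pos h, Nat.cast_le, ops_bind]
    have h1 := lowRankAdd_ops_le_size hV A (lowRankProduct B X Y t s r).val.2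
      ((Nat.add_le_add_left (hr X Y) k).trans hkM) s
    linarith [hp X Y]

theorem mulCost_le_of_not_isLeafTriple {K : Kernel} {V : ℕ} (hV : WorkBound T K N V)
    {B : BlockTree T} (hB : B.SizeBounds N P) (hN : (P + 2) * (k + k) ≤ N)
    {t s r : T.Node} (h : ¬ B.IsLeafTriple t s r) :
    mulCost K B k t s r ≤ (((20 * P + 60) * V * tripleSize t s r : ℕ) : ℝ≥0∞) +
      ∑ t' ∈ T.sonsPlus t, ∑ s' ∈ T.sonsPlus s, ∑ r' ∈ T.sonsPlus r,
          mulCost K B k t' s' r' := by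
  have hkk : k + k ≤ N := le_trans (Nat.le_mul_of_pos_left _ (by omega)) hN
  have v0 : 0 ≤ P * V * tripleSize t s r := Nat.zero_le _
  have v1 : 0 ≤ V * tripleSize t s r := Nat.zero_le _
  refine sup_le (iSup_le fun X => iSup_le fun Y => iSup_le fun Z => iSup_le fun htr => ?_)
    (iSup_le fun X => iSup_le fun Y => iSup_le fun A => ?_)
  · rw [mulUpdate, dif_neg h]
    split_ifs with hadm
    · refine (collect_ops_le K hB X Y t s r Z (fun t' r' C Z => lowRankUpdate K B Z t r
        (C.extend t r)) fun t' r' C Z => lowRankUpdate_ops_le_size hV hB Z _ hN s).trans ?_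
      gcongr
      rw [← Nat.cast_ofNat (n := 4), ← Nat.cast_mul, Nat.cast_le]
      linarith
    -- In `mulCost`, updates of `Z` are counted only for targets that are blocks. An inadmissible
    -- leaf `(t, r)` has two leaf clusters and recurs to itself; otherwise `(t, r)` is subdivided
    -- and the new targets are its sons.
    · have hblocks {t' r' : T.Node} (ht : t' ∈ T.sonsPlus t) (hr : r' ∈ T.sonsPlus r) :
          (t', r') ∈ B.blocks := by
        by_cases hs : B.sons (t, r) = ∅
        · obtain ⟨h1, h2⟩ := B.leaf_of_inadm t r htr hs hadm
          rw [ClusterTree.sonsPlus, if_pos h1, Finset.mem_singleton] at ht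
          rw [ClusterTree.sonsPlus, if_pos h2, Finset.mem_singleton] at hr
          rwa [ht, hr]
        · refine B.sons_subset (t, r) ?_
          rw [BlockTree.sons_eq_sonsPlus hs]
          exact Finset.mk_mem_product ht hr
      refine le_trans ?_ le_add_self
      refine (foldOver_ops_le (fun t' => ∑ r' ∈ T.sonsPlus r, ∑ s' ∈ T.sonsPlus s,
        mulCost K B k t' s' r') fun t' Z =>
        foldOver_ops_le (fun r' => ∑ s' ∈ T.sonsPlus s, mulCost K B k t' s' r')
        fun r' Z => foldOver_ops_le (fun s' => mulCost K B k t' s' r')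
        fun s' Z => mulUpdate_ops_le_mulCost K B X Y _ _ _ Z (hblocks t'.2 r'.2)).trans ?_
      exact le_of_eq (Finset.sum_congr rfl fun _ _ => Finset.sum_comm)
  · rw [mulTemp, dif_neg h]
    refine (collect_ops_le K hB X Y t s r A (fun t' r' C A => lowRankAdd K A (C.extend t r))
      fun t' r' C A => lowRankAdd_ops_le_size hV A _ hkk s).trans ?_
    gcongr
    rw [← Nat.cast_ofNat (n := 4), ← Nat.cast_mul, Nat.cast_le]
    linarith

/-- The factor in the bound for the work of one step of the multiplication. -/
def stepConst (qrConst svdConst P A L : ℕ) : ℕ :=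
  (20 * P + 60) * ((2 + qrConst + svdConst) * ((P + 2) * (L + 2)) ^ 3 * (A + 1))

theorem isMulBound_stepConst (K : Kernel) (B : BlockTree T) {qrConst svdConst A L : ℕ}
    (hqr : K.qrConst ≤ qrConst) (hsvd : K.svdConst ≤ svdConst)
    (hbin : ∀ t, (T.sons t).card ≤ 2)
    (hrow : ∀ t, (Finset.univ.filter fun s => (t, s) ∈ B.blocks).card ≤ P)
    (hcol : ∀ s, (Finset.univ.filter fun t => (t, s) ∈ B.blocks).card ≤ P)
    (htree : ∀ t, k * (T.subtree t).card ≤ A * (T.label t).card)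
    (hleaf : ∀ t, T.sons t = ∅ → (T.label t).card ≤ L * k) :
    IsMulBound K B k (stepConst qrConst svdConst P A L : ℕ) := by
  -- The product has rank at most `(L + 1) * k`, so the extended bases have at most `(L + 2) * k`
  -- columns, and the weight computation stacks fewer than `P + 2` such blocks.
  set D := (P + 2) * (L + 2) with hD
  have hD1 : 1 ≤ D := Nat.mul_pos (by omega) (by omega)
  have hLk : (L + 2) * k ≤ D * k := by
    gcongr; exact Nat.le_mul_of_pos_left _ (by omega)
  have hB : B.SizeBounds (D * k) P :=
    ⟨hbin, fun t h => (hleaf t h).trans (le_trans (by gcongr; omega) hLk), hrow, hcol⟩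
  have hw : K.weight ≤ 2 + qrConst + svdConst := by unfold Kernel.weight; omega
  -- With `A + 1` in place of `A`, the number `V` also bounds `K.weight * (D * k) ^ 2` when `A = 0`.
  set V := (2 + qrConst + svdConst) * D ^ 3 * (A + 1) * k ^ 2 with hVdef
  have hV : WorkBound T K (D * k) V := by
    constructor
    · intro t
      calc (T.subtree t).card * K.unit (D * k)
          = K.weight * D ^ 3 * k ^ 2 * (k * (T.subtree t).card) := by
            unfold Kernel.unit; ring
        _ ≤ (2 + qrConst + svdConst) * D ^ 3 * k ^ 2 * ((A + 1) * (T.label t).card) := by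
            refine Nat.mul_le_mul (by gcongr) ((htree t).trans ?_)
            gcongr
            omega
        _ = V * (T.label t).card := by rw [hVdef]; ring
    · calc K.weight * (D * k) ^ 2 = K.weight * D ^ 2 * 1 * k ^ 2 := by ring
        _ ≤ V := by
          rw [hVdef]
          gcongr <;> omega
  have hM : (P + 2) * (k + (L + 1) * k) ≤ D * k := le_of_eq (by rw [hD]; ring)
  have hM' : (P + 2) * (k + k) ≤ D * k :=
    le_trans (by gcongr; exact Nat.le_mul_of_pos_left _ (by omega)) hM
  have hconst (t s r : T.Node) : (((20 * P + 60) * V * tripleSize t s r : ℕ) : ℝ≥0∞) =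
      ((stepConst qrConst svdConst P A L : ℕ) : ℝ≥0) * k ^ 2 * (tripleSize t s r : ℝ≥0∞) := by
    rw [hVdef, stepConst, ← hD]
    push_cast
    ring
  intro t s r hts hsr
  constructor
  · intro h
    rw [← hconst]
    exact mulCost_le_of_isLeafTriple hV hB (M := (L + 1) * k)
      (Nat.le_mul_of_pos_left _ (by omega))
      (fun t h => (hleaf t h).trans (by gcongr; omega)) hM h hts hsr
  · intro h
    rw [← hconst]
    exact mulCost_le_of_not_isLeafTriple hV hB hM' h

/-! ### Sums over subtrees -/

namespace ClusterTree

theorem eq_or_exists_son_of_mem_subtree {t u : T.Node} (h : u ∈ T.subtree t) :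
    u = t ∨ ∃ v ∈ T.sons t, u ∈ T.subtree v := by
  rcases Relation.ReflTransGen.cases_head (mem_subtree.1 h) with h | ⟨v, h1, h2⟩
  · exact Or.inl h.symm
  · exact Or.inr ⟨v, mem_sons.2 h1, mem_subtree.2 h2⟩

theorem level_le_of_mem_subtree {t u : T.Node} (h : u ∈ T.subtree t) :
    T.level t ≤ T.level u := by
  rw [mem_subtree] at h
  induction h with
  | refl => exact le_rfl
  | tail _ h ih => rw [T.level_of_father _ _ h]; omega

theorem eq_of_mem_subtree_of_level_le {t u : T.Node} (h : u ∈ T.subtree t)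
    (hl : T.level u ≤ T.level t) : u = t := by
  rcases eq_or_exists_son_of_mem_subtree h with h | ⟨v, h1, h2⟩
  · exact h
  · have := T.level_of_father _ _ (mem_sons.1 h1)
    have := level_le_of_mem_subtree h2
    omega

/-- Fathers are unique, so the predecessors of `u` form a chain. -/
theorem mem_subtree_total {a b u : T.Node} (ha : u ∈ T.subtree a) (hb : u ∈ T.subtree b) :
    b ∈ T.subtree a ∨ a ∈ T.subtree b := by
  simp only [mem_subtree] at *
  rw [← Relation.reflTransGen_swap] at ha hb
  refine (Relation.ReflTransGen.total_of_right_unique ?_ ha hb).symm.imp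
    Relation.reflTransGen_swap.1 Relation.reflTransGen_swap.1
  intro x y z hy hz
  simp only [Function.swap] at hy hz
  exact Option.some_injective _ (hy.symm.trans hz)

/-- Two predecessors of `u` are comparable, and the elements of `sonsPlus t` all have the same
level. -/
theorem eq_of_mem_subtree_sonsPlus {t a b u : T.Node} (ha : a ∈ T.sonsPlus t)
    (hb : b ∈ T.sonsPlus t) (hua : u ∈ T.subtree a) (hub : u ∈ T.subtree b) : a = b := by
  have hl : T.level a = T.level b := by
    unfold sonsPlus at ha hb
    split_ifs at ha hb
    · rw [Finset.mem_singleton.1 ha, Finset.mem_singleton.1 hb]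
    · rw [T.level_of_father _ _ (mem_sons.1 ha), T.level_of_father _ _ (mem_sons.1 hb)]
  rcases mem_subtree_total hua hub with h | h
  · exact (eq_of_mem_subtree_of_level_le h hl.ge).symm
  · exact eq_of_mem_subtree_of_level_le h hl.le

theorem mem_subtree_of_mem_sonsPlus {t u : T.Node} (h : u ∈ T.sonsPlus t) : u ∈ T.subtree t := by
  unfold sonsPlus at h
  split_ifs at h
  · rw [Finset.mem_singleton.1 h]
    exact self_mem_subtree t
  · exact mem_subtree.2 (.single (mem_sons.1 h))

theorem subtree_trans {t u v : T.Node} (h : u ∈ T.subtree t) (h' : v ∈ T.subtree u) :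
    v ∈ T.subtree t :=
  mem_subtree.2 ((mem_subtree.1 h).trans (mem_subtree.1 h'))

theorem sum_card_label_sons_le (t : T.Node) :
    ∑ u ∈ T.sons t, (T.label u).card ≤ (T.label t).card := by
  by_cases h : (T.sons t).Nonempty
  · have h1 : T.label t = (T.sons t).biUnion T.label := T.label_eq_biUnion t h
    rw [h1, Finset.card_biUnion]
    intro a ha b hb hab
    exact T.label_disjoint t a b (mem_sons.1 ha) (mem_sons.1 hb) hab
  · simp [Finset.not_nonempty_iff_eq_empty.1 h]

/-- By induction on the remaining height `depth - level t`: the subtrees of the sons have smaller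
height, and the labels of the sons are disjoint parts of the label of `t`. -/
theorem sum_card_label_subtree_le (t : T.Node) :
    ∑ u ∈ T.subtree t, (T.label u).card ≤ (T.depth - T.level t + 1) * (T.label t).card := by
  induction hd : T.depth - T.level t using Nat.strong_induction_on generalizing t with
  | _ d ih =>
    classical
    have hsub : T.subtree t ⊆ insert t ((T.sons t).biUnion T.subtree) := fun u hu => by
      simpa using eq_or_exists_son_of_mem_subtree hu
    have hnot : t ∉ (T.sons t).biUnion T.subtree := by
      intro h
      obtain ⟨v, hv, htv⟩ := Finset.mem_biUnion.1 h
      have := T.level_of_father _ _ (mem_sons.1 hv)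
      have := level_le_of_mem_subtree htv
      omega
    have hdisj : Set.PairwiseDisjoint (T.sons t : Set T.Node) T.subtree := by
      intro a ha b hb hab
      rw [Function.onFun, Finset.disjoint_left]
      intro u hua hub
      have hne : T.sons t ≠ ∅ := Finset.ne_empty_of_mem (Finset.mem_coe.1 ha)
      refine hab (eq_of_mem_subtree_sonsPlus (t := t) ?_ ?_ hua hub) <;>
        rwa [sonsPlus, if_neg hne]
    calc ∑ u ∈ T.subtree t, (T.label u).card
        ≤ ∑ u ∈ insert t ((T.sons t).biUnion T.subtree), (T.label u).card :=
          Finset.sum_le_sum_of_subset hsub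
      _ = (T.label t).card + ∑ v ∈ T.sons t, ∑ u ∈ T.subtree v, (T.label u).card := by
          rw [Finset.sum_insert hnot, Finset.sum_biUnion hdisj]
      _ ≤ (T.label t).card + ∑ v ∈ T.sons t, d * (T.label v).card := by
          gcongr with v hv
          have hlt := rem_son_lt hv
          refine (ih _ (hd ▸ hlt) v rfl).trans ?_
          gcongr
          omega
      _ ≤ (T.label t).card + d * (T.label t).card := by
          rw [← Finset.mul_sum]
          gcongr
          exact sum_card_label_sons_le t
      _ = (d + 1) * (T.label t).card := by ring

end ClusterTree

/-! ### Sums over the triple tree -/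

namespace BlockTree

variable (B : BlockTree T)

/-- The relation between a triple and its sons in the triple tree. -/
def IsTripleSon (p q : T.Node × T.Node × T.Node) : Prop :=
  ¬ B.IsLeafTriple p.1 p.2.1 p.2.2 ∧
    q ∈ T.sonsPlus p.1 ×ˢ T.sonsPlus p.2.1 ×ˢ T.sonsPlus p.2.2

open scoped Classical in
/-- The descendants of a triple in the triple tree, including the triple itself. -/
def descendants (p : T.Node × T.Node × T.Node) : Finset (T.Node × T.Node × T.Node) :=
  Finset.univ.filter fun q => Relation.ReflTransGen B.IsTripleSon p q

variable {B}

theorem mem_descendants {p q : T.Node × T.Node × T.Node} :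
    q ∈ B.descendants p ↔ Relation.ReflTransGen B.IsTripleSon p q := by
  simp [descendants]

theorem self_mem_descendants (p : T.Node × T.Node × T.Node) : p ∈ B.descendants p :=
  mem_descendants.2 .refl

/-- The height of a triple with respect to the deepest possible triple. -/
def tripleRem (p : T.Node × T.Node × T.Node) : ℕ :=
  (T.depth - T.level p.1) + (T.depth - T.level p.2.1) + (T.depth - T.level p.2.2)

theorem IsTripleSon.tripleRem_lt {p q : T.Node × T.Node × T.Node} (h : B.IsTripleSon p q) :
    tripleRem q < tripleRem p := by
  obtain ⟨h1, h2⟩ := h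
  simp only [Finset.mem_product] at h2
  exact rem_triple_lt h1 h2.1 h2.2.1 h2.2.2

theorem tripleRem_le_of_mem_descendants {p q : T.Node × T.Node × T.Node}
    (h : q ∈ B.descendants p) : tripleRem q ≤ tripleRem p := by
  rw [mem_descendants] at h
  induction h with
  | refl => exact le_rfl
  | tail _ h ih => exact h.tripleRem_lt.le.trans ih

theorem mem_subtree_of_mem_descendants {p q : T.Node × T.Node × T.Node}
    (h : q ∈ B.descendants p) :
    q.1 ∈ T.subtree p.1 ∧ q.2.1 ∈ T.subtree p.2.1 ∧ q.2.2 ∈ T.subtree p.2.2 := by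
  rw [mem_descendants] at h
  induction h with
  | refl => simp [ClusterTree.self_mem_subtree]
  | tail _ h ih =>
    have h2 := h.2
    simp only [Finset.mem_product] at h2
    exact ⟨ClusterTree.subtree_trans ih.1 (ClusterTree.mem_subtree_of_mem_sonsPlus h2.1),
      ClusterTree.subtree_trans ih.2.1 (ClusterTree.mem_subtree_of_mem_sonsPlus h2.2.1),
      ClusterTree.subtree_trans ih.2.2 (ClusterTree.mem_subtree_of_mem_sonsPlus h2.2.2)⟩

theorem IsTripleSon.mem_blocks {p q : T.Node × T.Node × T.Node} (h : B.IsTripleSon p q) :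
    (q.1, q.2.1) ∈ B.blocks ∧ (q.2.1, q.2.2) ∈ B.blocks := by
  obtain ⟨h1, h2⟩ := h
  simp only [Finset.mem_product] at h2
  unfold IsLeafTriple at h1
  push Not at h1
  constructor
  · refine B.sons_subset (p.1, p.2.1) ?_
    rw [sons_eq_sonsPlus (Finset.nonempty_iff_ne_empty.1 h1.1)]
    exact Finset.mk_mem_product h2.1 h2.2.1
  · refine B.sons_subset (p.2.1, p.2.2) ?_
    rw [sons_eq_sonsPlus (Finset.nonempty_iff_ne_empty.1 h1.2)]
    exact Finset.mk_mem_product h2.2.1 h2.2.2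

/-- No induction is needed: a triple other than the root has a subdivided predecessor, and sons of
blocks are blocks. -/
theorem IsTriple.mem_blocks {t s r : T.Node} (h : B.IsTriple t s r) :
    (t, s) ∈ B.blocks ∧ (s, r) ∈ B.blocks := by
  cases h with
  | root => exact ⟨B.root_mem, B.root_mem⟩
  | @son t' s' r' _ _ _ _ h1 h2 h3 h4 =>
    exact IsTripleSon.mem_blocks (p := (t', s', r')) (q := (t, s, r))
      ⟨h1, by simp only [Finset.mem_product]; exact ⟨h2, h3, h4⟩⟩

theorem mem_blocks_of_mem_descendants {p q : T.Node × T.Node × T.Node}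
    (hp : (p.1, p.2.1) ∈ B.blocks ∧ (p.2.1, p.2.2) ∈ B.blocks) (h : q ∈ B.descendants p) :
    (q.1, q.2.1) ∈ B.blocks ∧ (q.2.1, q.2.2) ∈ B.blocks := by
  rcases Relation.ReflTransGen.cases_tail (mem_descendants.1 h) with h | ⟨_, _, h⟩
  · rwa [h]
  · exact h.mem_blocks

/-- Since `descendants` is a set, no triple may be reached through two sons. Distinct sons differ in
a component, and the subtrees of distinct elements of `sonsPlus` are disjoint. The triple `p` itself
is not met again because `tripleRem` strictly decreases. -/
theorem add_sum_sons_le_sum_descendants (f : T.Node × T.Node × T.Node → ℕ)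
    {p : T.Node × T.Node × T.Node} (h : ¬ B.IsLeafTriple p.1 p.2.1 p.2.2) :
    f p + ∑ q ∈ T.sonsPlus p.1 ×ˢ T.sonsPlus p.2.1 ×ˢ T.sonsPlus p.2.2,
      ∑ x ∈ B.descendants q, f x ≤ ∑ x ∈ B.descendants p, f x := by
  classical
  set S := T.sonsPlus p.1 ×ˢ T.sonsPlus p.2.1 ×ˢ T.sonsPlus p.2.2 with hS
  have hson {q : T.Node × T.Node × T.Node} (hq : q ∈ S) : B.IsTripleSon p q := ⟨h, hq⟩
  have hdisj : Set.PairwiseDisjoint (S : Set (T.Node × T.Node × T.Node)) B.descendants := by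
    intro a ha b hb hab
    rw [Function.onFun, Finset.disjoint_left]
    intro u hua hub
    have ha' := Finset.mem_coe.1 ha
    have hb' := Finset.mem_coe.1 hb
    simp only [hS, Finset.mem_product] at ha' hb'
    obtain ⟨a1, a2, a3⟩ := mem_subtree_of_mem_descendants hua
    obtain ⟨b1, b2, b3⟩ := mem_subtree_of_mem_descendants hub
    exact hab (Prod.ext (ClusterTree.eq_of_mem_subtree_sonsPlus ha'.1 hb'.1 a1 b1)
      (Prod.ext (ClusterTree.eq_of_mem_subtree_sonsPlus ha'.2.1 hb'.2.1 a2 b2)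
        (ClusterTree.eq_of_mem_subtree_sonsPlus ha'.2.2 hb'.2.2 a3 b3)))
  have hnot : p ∉ S.biUnion B.descendants := by
    intro hp
    obtain ⟨q, hq, hpq⟩ := Finset.mem_biUnion.1 hp
    exact absurd (tripleRem_le_of_mem_descendants hpq) (hson hq).tripleRem_lt.not_ge
  rw [← Finset.sum_biUnion hdisj, ← Finset.sum_insert hnot]
  refine Finset.sum_le_sum_of_subset fun x hx => ?_
  rcases Finset.mem_insert.1 hx with rfl | hx
  · exact self_mem_descendants _
  · obtain ⟨q, hq, hxq⟩ := Finset.mem_biUnion.1 hx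
    exact mem_descendants.2 ((mem_descendants.1 hxq).head (hson hq))

end BlockTree

/-! ### Unrolling the recursion and counting triples -/

open BlockTree

/-- By induction on `tripleRem`. Only the block property of the two factors is needed, and it passes
from a triple to its sons. -/
theorem mulCost_le_sum_descendants {K : Kernel} {B : BlockTree T} {k : ℕ} {C : ℝ≥0}
    (hC : IsMulBound K B k C) (p : T.Node × T.Node × T.Node)
    (hp : (p.1, p.2.1) ∈ B.blocks ∧ (p.2.1, p.2.2) ∈ B.blocks) :
    mulCost K B k p.1 p.2.1 p.2.2 ≤ C * k ^ 2 *
      ((∑ q ∈ B.descendants p, tripleSize q.1 q.2.1 q.2.2 : ℕ) : ℝ≥0∞) := by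
  induction hd : tripleRem p using Nat.strong_induction_on generalizing p with
  | _ d ih =>
    obtain ⟨h1, h2⟩ := hC p.1 p.2.1 p.2.2 hp.1 hp.2
    by_cases h : B.IsLeafTriple p.1 p.2.1 p.2.2
    · refine (h1 h).trans ?_
      gcongr
      exact Finset.single_le_sum (f := fun q : T.Node × T.Node × T.Node =>
        tripleSize q.1 q.2.1 q.2.2) (fun _ _ => Nat.zero_le _) (self_mem_descendants p)
    · refine (h2 h).trans ?_
      have hs : ∑ t' ∈ T.sonsPlus p.1, ∑ s' ∈ T.sonsPlus p.2.1, ∑ r' ∈ T.sonsPlus p.2.2,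
          mulCost K B k t' s' r' =
          ∑ q ∈ T.sonsPlus p.1 ×ˢ T.sonsPlus p.2.1 ×ˢ T.sonsPlus p.2.2,
            mulCost K B k q.1 q.2.1 q.2.2 := by
        simp only [Finset.sum_product]
      rw [hs]
      calc _ ≤ C * k ^ 2 * (tripleSize p.1 p.2.1 p.2.2 : ℝ≥0∞) +
            ∑ q ∈ T.sonsPlus p.1 ×ˢ T.sonsPlus p.2.1 ×ˢ T.sonsPlus p.2.2, C * k ^ 2 *
              ((∑ x ∈ B.descendants q, tripleSize x.1 x.2.1 x.2.2 : ℕ) : ℝ≥0∞) := by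
            gcongr with q hq
            have hq' : B.IsTripleSon p q := ⟨h, hq⟩
            exact ih _ (hd ▸ hq'.tripleRem_lt) q hq'.mem_blocks rfl
        _ = C * k ^ 2 * ((tripleSize p.1 p.2.1 p.2.2 +
            ∑ q ∈ T.sonsPlus p.1 ×ˢ T.sonsPlus p.2.1 ×ˢ T.sonsPlus p.2.2,
              ∑ x ∈ B.descendants q, tripleSize x.1 x.2.1 x.2.2 : ℕ) : ℝ≥0∞) := by
            rw [← Finset.mul_sum, ← mul_add]
            push_cast
            rfl
        _ ≤ _ := by
            gcongr
            exact add_sum_sons_le_sum_descendants (fun x => tripleSize x.1 x.2.1 x.2.2) h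

/-- A sum over a set of triples in which each cluster of a subtree occurs at most `c` times. -/
theorem sum_card_label_le {α : Type} (D : Finset α) (g : α → T.Node) (t : T.Node) {c : ℝ≥0}
    (hg : ∀ x ∈ D, g x ∈ T.subtree t)
    (hc : ∀ u, ((D.filter fun x => g x = u).card : ℝ≥0) ≤ c) :
    ((∑ x ∈ D, (T.label (g x)).card : ℕ) : ℝ≥0) ≤ c * ((T.depth + 1) * (T.label t).card) := by
  rw [← Finset.sum_fiberwise_of_maps_to hg, Nat.cast_sum]
  calc ∑ u ∈ T.subtree t, ((∑ x ∈ D with g x = u, (T.label (g x)).card : ℕ) : ℝ≥0)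
      ≤ ∑ u ∈ T.subtree t, c * ((T.label u).card : ℝ≥0) := by
        refine Finset.sum_le_sum fun u _ => ?_
        rw [Finset.sum_congr rfl (g := fun _ => (T.label u).card)
          (fun x hx => by rw [(Finset.mem_filter.1 hx).2])]
        simp only [Finset.sum_const, smul_eq_mul, Nat.cast_mul]
        gcongr
        exact hc u
    _ = c * ((∑ u ∈ T.subtree t, (T.label u).card : ℕ) : ℝ≥0) := by
        rw [← Finset.mul_sum]
        push_cast
        rfl
    _ ≤ c * (((T.depth + 1) * (T.label t).card : ℕ) : ℝ≥0) := by
        gcongr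
        refine (ClusterTree.sum_card_label_subtree_le t).trans ?_
        gcongr
        omega
    _ = _ := by push_cast; rfl

/-- The number of pairs `(a, b)` such that `a` satisfies `p` and `b` satisfies `q a`. -/
theorem card_pairs_le {α β γ : Type} [Fintype α] [Fintype β] {c : ℝ≥0} (p : α → Prop)
    (q : α → β → Prop) [DecidablePred p] [∀ a, DecidablePred (q a)]
    (hp : ((Finset.univ.filter p).card : ℝ≥0) ≤ c)
    (hq : ∀ a, ((Finset.univ.filter (q a)).card : ℝ≥0) ≤ c)
    (D : Finset γ) (f : γ → α × β) (hf : Set.InjOn f D)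
    (hD : ∀ x ∈ D, p (f x).1 ∧ q (f x).1 (f x).2) : (D.card : ℝ≥0) ≤ c ^ 2 := by
  classical
  have h1 : D.card ≤ ∑ a ∈ Finset.univ.filter p, (Finset.univ.filter (q a)).card := by
    rw [← Finset.card_sigma]
    refine Finset.card_le_card_of_injOn (fun x => ⟨(f x).1, (f x).2⟩) ?_ ?_
    · intro x hx
      simpa using hD x hx
    · intro x hx y hy e
      simp only [Sigma.mk.injEq, heq_eq_eq] at e
      exact hf hx hy (Prod.ext e.1 e.2)
  calc (D.card : ℝ≥0) ≤ ((∑ a ∈ Finset.univ.filter p, (Finset.univ.filter (q a)).card : ℕ) : ℝ≥0) :=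
        Nat.cast_le.2 h1
    _ ≤ ∑ a ∈ Finset.univ.filter p, c := by
        rw [Nat.cast_sum]
        exact Finset.sum_le_sum fun a _ => hq a
    _ = (Finset.univ.filter p).card * c := by simp
    _ ≤ c * c := by gcongr
    _ = c ^ 2 := (sq c).symm

/-- The three components are counted separately. For fixed `t`, choose `s` in the block row of `t`
and `r` in that of `s`; for fixed `s`, choose `t` in its block column and `r` in its block row; for
fixed `r`, choose `s` in its block column and `t` in that of `s`. -/
theorem sum_tripleSize_descendants_le {B : BlockTree T} {c : ℝ≥0} (hB : B.IsSparse c)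
    (p : T.Node × T.Node × T.Node)
    (hp : (p.1, p.2.1) ∈ B.blocks ∧ (p.2.1, p.2.2) ∈ B.blocks) :
    ((∑ q ∈ B.descendants p, tripleSize q.1 q.2.1 q.2.2 : ℕ) : ℝ≥0) ≤
      c ^ 2 * ((T.depth + 1) * tripleSize p.1 p.2.1 p.2.2) := by
  have hD {q : T.Node × T.Node × T.Node} (hq : q ∈ B.descendants p) :=
    mem_blocks_of_mem_descendants hp hq
  have h1 := sum_card_label_le (B.descendants p) (fun q => q.1) p.1 (c := c ^ 2)
    (fun q hq => (mem_subtree_of_mem_descendants hq).1) fun u =>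
      card_pairs_le (fun s => (u, s) ∈ B.blocks) (fun s r => (s, r) ∈ B.blocks) (hB.1 u) hB.1 _
        (fun q => q.2) (fun x hx y hy e => Prod.ext
          ((Finset.mem_filter.1 hx).2.trans (Finset.mem_filter.1 hy).2.symm) e) fun x hx => by
          obtain ⟨hx', rfl⟩ := Finset.mem_filter.1 hx
          exact hD hx'
  have h2 := sum_card_label_le (B.descendants p) (fun q => q.2.1) p.2.1 (c := c ^ 2)
    (fun q hq => (mem_subtree_of_mem_descendants hq).2.1) fun u =>
      card_pairs_le (fun t => (t, u) ∈ B.blocks) (fun _ r => (u, r) ∈ B.blocks) (hB.2 u)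
        (fun _ => hB.1 u) _
        (fun q => (q.1, q.2.2)) (fun x hx y hy e => by
          have hu := (Finset.mem_filter.1 hx).2.trans (Finset.mem_filter.1 hy).2.symm
          simp only [Prod.mk.injEq] at e
          exact Prod.ext e.1 (Prod.ext hu e.2)) fun x hx => by
          obtain ⟨hx', rfl⟩ := Finset.mem_filter.1 hx
          exact hD hx'
  have h3 := sum_card_label_le (B.descendants p) (fun q => q.2.2) p.2.2 (c := c ^ 2)
    (fun q hq => (mem_subtree_of_mem_descendants hq).2.2) fun u =>
      card_pairs_le (fun s => (s, u) ∈ B.blocks) (fun s t => (t, s) ∈ B.blocks) (hB.2 u) hB.2 _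
        (fun q => (q.2.1, q.1)) (fun x hx y hy e => by
          have hu := (Finset.mem_filter.1 hx).2.trans (Finset.mem_filter.1 hy).2.symm
          simp only [Prod.mk.injEq] at e
          exact Prod.ext e.2 (Prod.ext e.1 hu)) fun x hx => by
          obtain ⟨hx', rfl⟩ := Finset.mem_filter.1 hx
          exact (hD hx').symm
  simp only [tripleSize, Finset.sum_add_distrib, Nat.cast_add, mul_add]
  exact add_le_add (add_le_add h1 h2) h3

end H2Mult

end

/-! ### The complexity theorem -/

theorem mainTheorem2 (qrConst svdConst : ℕ) (Csp Ctree Clf : ℝ≥0) :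
    ∃ Cmb₀ : ℝ≥0,
      ∀ (I : Type) [Fintype I] [DecidableEq I] (T : H2Mult.ClusterTree I)
        (B : H2Mult.BlockTree T) (K : H2Mult.Kernel) (k : ℕ),
        K.qrConst ≤ qrConst → K.svdConst ≤ svdConst → 1 ≤ k →
        T.IsBinary → B.IsSparse Csp →
        (∀ t : T.Node, (k : ℝ≥0) ^ 3 * ((T.subtree t).card : ℝ≥0) ≤
          Ctree * ((k : ℝ≥0) ^ 2 * ((T.label t).card : ℝ≥0))) →
        (∀ t : T.Node, T.sons t = ∅ → ((T.label t).card : ℝ≥0) ≤ Clf * (k : ℝ≥0)) →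
        H2Mult.IsMulBound K B k Cmb₀ ∧
        ∀ Cmb : ℝ≥0, H2Mult.IsMulBound K B k Cmb →
          ∀ t₀ s₀ r₀ : T.Node, B.IsTriple t₀ s₀ r₀ →
            H2Mult.mulCost K B k t₀ s₀ r₀ ≤
              ((Csp ^ 2 * Cmb : ℝ≥0) : ℝ≥0∞) * (k : ℝ≥0∞) ^ 2 * ((T.depth : ℝ≥0∞) + 1) *
                (H2Mult.tripleSize t₀ s₀ r₀ : ℝ≥0∞) := by
  -- The operation counts are natural numbers, so the real constants are rounded up. This affects
  -- only the existence of `Cmb₀`.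
  refine ⟨(H2Mult.stepConst qrConst svdConst ⌈Csp⌉₊ ⌈Ctree⌉₊ ⌈Clf⌉₊ : ℕ), ?_⟩
  intro I _ _ T B K k hqr hsvd hk hbin hsp htree hleaf
  constructor
  · refine H2Mult.isMulBound_stepConst K B hqr hsvd ?_ ?_ ?_ ?_ ?_
    · intro t
      rcases hbin t with h | h <;> simp [h]
    · exact fun t => Nat.cast_le.1 ((hsp.1 t).trans (Nat.le_ceil Csp))
    · exact fun s => Nat.cast_le.1 ((hsp.2 s).trans (Nat.le_ceil Csp))
    · intro t
      -- The assumption `1 ≤ k` allows the common factor `k ^ 2` to be cancelled.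
      have hk0 : (0 : ℝ≥0) < (k : ℝ≥0) ^ 2 := pow_pos (Nat.cast_pos.2 hk) 2
      have h1 : (k : ℝ≥0) ^ 2 * ((k : ℝ≥0) * (T.subtree t).card) ≤
          (k : ℝ≥0) ^ 2 * (Ctree * (T.label t).card) := by
        calc _ = (k : ℝ≥0) ^ 3 * ((T.subtree t).card : ℝ≥0) := by ring
          _ ≤ _ := htree t
          _ = _ := by ring
      have h2 := (le_of_mul_le_mul_left h1 hk0).trans
        (mul_le_mul_left (Nat.le_ceil Ctree) _)
      exact_mod_cast h2
    · intro t h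
      have h2 := (hleaf t h).trans (mul_le_mul_left (Nat.le_ceil Clf) _)
      exact_mod_cast h2
  -- Here the sparsity bound is used with `Csp` itself, as the constant `Csp ^ 2 * Cmb` requires.
  · intro C hC t s r h
    refine (H2Mult.mulCost_le_sum_descendants hC (t, s, r) h.mem_blocks).trans ?_
    have h1 := H2Mult.sum_tripleSize_descendants_le hsp (t, s, r) h.mem_blocks
    have h2 := ENNReal.coe_le_coe.2 (mul_le_mul_right h1 (C * (k : ℝ≥0) ^ 2))
    refine (le_of_eq ?_).trans (h2.trans (le_of_eq ?_))
    · push_cast; rfl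
    · push_cast; ring
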